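/- **Setting.** Let $\mathfrak g=\mathfrak g_{-1}\oplus\mathfrak g_0\oplus\mathfrak g_1$ be a $|1|$-graded real semisimple Lie algebra: $[\mathfrak g_i,\mathfrak g_j]\subset\mathfrak g_{i+j}$ (with $\mathfrak g_r=0$ for $|r|>1$), $\mathfrak g_{-1}\neq 0$, and no simple ideal of $\mathfrak g$ is contained in $\mathfrak g_0$. Put $\mathfrak g^i=\bigoplus_{j\ge i}\mathfrak g_j$ and $\mathfrak p=\mathfrak g^0=\mathfrak g_0\oplus\mathfrak g_1$. Let $G$ be a Lie group with Lie algebra $\mathfrak g$, and let $P\subset G$ be an embedded Lie subgroup with Lie algebra $\mathfrak p$ such that $\mathrm{Ad}_g(\mathfrak g^i)\subset\mathfrak g^i$ for all $g\in P$ and all $i$. For $g\in P$ let $\underline{\mathrm{Ad}}_g$ be the action on $\mathfrak g_{-1}\cong\mathfrak g/\mathfrak p$ induced by $\mathrm{Ad}_g$. The manifold $G/P$ carries its smooth structure as a homogeneous space, for which $G\to G/P$ is a submersion, and $o=eP$ denotes the origin. A *Cartan geometry of type $(G,P)$* on a smooth manifold $M$ is a smooth principal $P$-bundle $p:\mathcal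 G\to M$ with a smooth $1$-form $\omega\in\Omega^1(\mathcal G,\mathfrak g)$ such that $(r^h)^*\omega=\mathrm{Ad}_{h^{-1}}\circ\omega$ for $h\in P$, $\omega(\zeta_X)=X$ for the fundamental vector fields $\zeta_X$, $X\in\mathfrak p$, and $\omega(u):T_u\mathcal G\to\mathfrak g$ is a linear isomorphism for every $u$. The *homogeneous model* is $G\to G/P$ with the left Maurer–Cartan form $\omega_G$. A *symmetry with center $x\in M$* is a locally defined diffeomorphism $s$ of $M$ with $s(x)=x$ and $T_xs=-\mathrm{id}_{T_xM}$ such that, on some open neighborhood $U$ of $x$, $s$ is covered by an automorphism of the Cartan geometry, i.e. by a $P$-equivariant diffeomorphism $\varphi$ from $p^{-1}(U)$ onto an open subset of $\mathcal G$ with $\varphi^*\omega=\omega$. The geometry is *symmetric* if there is a symmetry with center $x$ for each $x\in M$. **Proposition.** 1. The symmetries of the homogeneous model with center $o$ are exactly the left multiplications by the elements $g\in P$ with $\underline{\mathrm{Ad}}_g(X)=-X$ for all $X\in\mathfrak g_{-1}$. Precisely: a local diffeomorphism $s$ of $G/P$ defined near $o$ is a symmetry with center $o$ if and only if it coincides near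 $o$ with the left multiplication $\ell_g$ by such an element $g$; if $s$ is covered by an automorphism over a connected open neighborhood $U$ of $o$, then $s=\ell_g$ on all of $U$ for such a $g$; and for each such $g$ the map $\ell_g$ is a symmetry with center $o$ defined, and covered by an automorphism, on all of $G/P$. 2. If there is a symmetry of the homogeneous model with center $o$, then the homogeneous model is symmetric, and at each point of $G/P$ there are infinitely many symmetries with that center (even infinitely many distinct germs). 3. If no $g\in P$ satisfies $\underline{\mathrm{Ad}}_g(X)=-X$ for all $X\in\mathfrak g_{-1}$, then no Cartan geometry of type $(G,P)$, on any smooth manifold, admits a symmetry with any center. -/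

import Mathlib

open scoped Manifold ContDiff Topology

instance instLEInftyMinSmoothnessReal : ENat.LEInfty (minSmoothness ℝ 3) := by
  rw [minSmoothness_of_isRCLikeNormedField]; infer_instance

namespace ParabolicGeometry

/-! ### `|1|`-graded semisimple Lie algebras -/

/-- A `|1|`-grading `𝔤 = 𝔤₋₁ ⊕ 𝔤₀ ⊕ 𝔤₁` of a real Lie algebra, written as a `ℤ`-grading
concentrated in degrees `-1, 0, 1`.  The grading has length exactly one (`𝔤₋₁ ≠ 0`), and no simple
ideal of `𝔤` is contained in `𝔤₀`. -/
structure OneGrading (𝔤 : Type*) [LieRing 𝔤] [LieAlgebra ℝ 𝔤] where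
  gr : ℤ → Submodule ℝ 𝔤
  isInternal : DirectSum.IsInternal gr
  gr_eq_bot : ∀ i : ℤ, 1 < |i| → gr i = ⊥
  lie_mem : ∀ i j : ℤ, ∀ X ∈ gr i, ∀ Y ∈ gr j, ⁅X, Y⁆ ∈ gr (i + j)
  gr_neg_one_ne_bot : gr (-1) ≠ ⊥
  not_le_gr_zero : ∀ J : LieIdeal ℝ 𝔤, LieAlgebra.IsSimple ℝ J → ¬ J.toSubmodule ≤ gr 0

namespace OneGrading

variable {𝔤 : Type*} [LieRing 𝔤] [LieAlgebra ℝ 𝔤] (D : OneGrading 𝔤)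

/-- The filtration `𝔤ⁱ = 𝔤ᵢ ⊕ 𝔤ᵢ₊₁ ⊕ ⋯`; in particular `𝔭 = 𝔤⁰ = 𝔤₀ ⊕ 𝔤₁`. -/
def filt (i : ℤ) : Submodule ℝ 𝔤 := ⨆ j : ℤ, ⨆ _ : i ≤ j, D.gr j

/-- The component of `X` in `𝔤ᵢ`. -/
noncomputable def proj (i : ℤ) (X : 𝔤) : 𝔤 :=
  letI := D.isInternal.chooseDecomposition
  (DirectSum.decompose D.gr X i : 𝔤)

end OneGrading

/-! ### Lie groups, the adjoint action, parabolic subgroups -/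

section Groups

variable {n : ℕ} {G : Type*} [Group G] [TopologicalSpace G]
  [ChartedSpace (EuclideanSpace ℝ (Fin n)) G]

/-- The adjoint action `Ad_g : 𝔤 → 𝔤`, the differential at the unit of `x ↦ g x g⁻¹`. -/
noncomputable def Ad (g : G) : GroupLieAlgebra (𝓡 n) G →L[ℝ] GroupLieAlgebra (𝓡 n) G :=
  mfderiv (𝓡 n) (𝓡 n) (fun x : G => g * x * g⁻¹) 1

/-- The (left) Maurer-Cartan form `ω_G(g)(ξ) = T_g ℓ_{g⁻¹} ξ`. -/
noncomputable def maurerCartan (g : G) :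
    TangentSpace (𝓡 n) g →L[ℝ] GroupLieAlgebra (𝓡 n) G :=
  (mfderiv (𝓡 n) (𝓡 n) (fun x : G => g⁻¹ * x) g :
    EuclideanSpace ℝ (Fin n) →L[ℝ] EuclideanSpace ℝ (Fin n))

variable [LieGroup (𝓡 n) ∞ G]

/-- The action `X ↦ π(Ad_g X)` induced by the adjoint action on `𝔤₋₁ ≅ 𝔤/𝔭`, where
`π : 𝔤 → 𝔤₋₁` is the projection in the direction of `𝔭` (meaningful for `g ∈ P`). -/
noncomputable def AdBar (D : OneGrading (GroupLieAlgebra (𝓡 n) G)) (g : G)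
    (X : GroupLieAlgebra (𝓡 n) G) : GroupLieAlgebra (𝓡 n) G :=
  D.proj (-1) (Ad g X)

/-- `g` acts as `-id` on `𝔤₋₁`. -/
def ActsAsNegId (D : OneGrading (GroupLieAlgebra (𝓡 n) G)) (g : G) : Prop :=
  ∀ X ∈ D.gr (-1), AdBar D g X = -X

/-- `P` is a parabolic subgroup for the graded Lie algebra `𝔤`: an (embedded) Lie subgroup of `G`
with Lie algebra `𝔭 = 𝔤⁰`, contained in the maximal one, `{g | Ad_g(𝔤ⁱ) ⊆ 𝔤ⁱ for all i}`.
(Having Lie algebra `𝔭`, it automatically contains the unit component of the maximal one.) -/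
structure IsParabolicSubgroup (p : ℕ) (D : OneGrading (GroupLieAlgebra (𝓡 n) G)) (P : Subgroup G)
    [ChartedSpace (EuclideanSpace ℝ (Fin p)) P] : Prop where
  isSmoothEmbedding : Manifold.IsSmoothEmbedding (𝓡 p) (𝓡 n) ∞ (Subtype.val : P → G)
  range_eq : Set.range (mfderiv (𝓡 p) (𝓡 n) (Subtype.val : P → G) 1) = D.filt 0
  ad_mem : ∀ g ∈ P, ∀ i : ℤ, ∀ X ∈ D.filt i, Ad g X ∈ D.filt i

end Groups

/-! ### Cartan geometries -/

section Cartan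

/-- A Cartan geometry of type `(G, P)`: a smooth principal (right) `P`-bundle `proj : B → M`
together with a Cartan connection `omega ∈ Ω¹(B, 𝔤)`.  The numbers `n, p, b, m` are the dimensions
of the manifolds `G, P, B, M`. -/
structure CartanGeometry (n p b m : ℕ) {G : Type*} [Group G] [TopologicalSpace G]
    [ChartedSpace (EuclideanSpace ℝ (Fin n)) G] [LieGroup (𝓡 n) ∞ G]
    (P : Subgroup G) [ChartedSpace (EuclideanSpace ℝ (Fin p)) P] [LieGroup (𝓡 p) ∞ P]
    (B : Type*) [TopologicalSpace B] [ChartedSpace (EuclideanSpace ℝ (Fin b)) B]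
    [IsManifold (𝓡 b) ∞ B]
    (M : Type*) [TopologicalSpace M] [ChartedSpace (EuclideanSpace ℝ (Fin m)) M]
    [IsManifold (𝓡 m) ∞ M] where
  /-- the bundle projection -/
  proj : B → M
  /-- the right action of `P` -/
  act : B → P → B
  act_one : ∀ u, act u 1 = u
  act_mul : ∀ u h k, act u (h * k) = act (act u h) k
  contMDiff_act : ContMDiff ((𝓡 b).prod (𝓡 p)) (𝓡 b) ∞ (fun v : B × P => act v.1 v.2)
  proj_act : ∀ u h, proj (act u h) = proj u
  /-- smooth `P`-equivariant local triviality -/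
  locallyTrivial : ∀ x : M, ∃ e : Bundle.Trivialization P proj, x ∈ e.baseSet ∧
    ContMDiffOn (𝓡 b) ((𝓡 m).prod (𝓡 p)) ∞ e e.source ∧
    ContMDiffOn ((𝓡 m).prod (𝓡 p)) (𝓡 b) ∞ e.toOpenPartialHomeomorph.symm e.target ∧
    ∀ u ∈ e.source, ∀ h : P, e (act u h) = ((e u).1, (e u).2 * h)
  /-- the Cartan connection -/
  omega : ∀ u : B, TangentSpace (𝓡 b) u →L[ℝ] GroupLieAlgebra (𝓡 n) G
  /-- `ω` is smooth, as a map `TB → 𝔤` -/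
  contMDiff_omega : ContMDiff (M' := EuclideanSpace ℝ (Fin n)) (𝓡 b).tangent (𝓡 n) ∞
    (fun v : TangentBundle (𝓡 b) B => omega v.proj v.2)
  /-- `(rʰ)^* ω = Ad_{h⁻¹} ∘ ω` -/
  omega_equivariant : ∀ (h : P) (u : B) (ξ : TangentSpace (𝓡 b) u),
    omega (act u h) (mfderiv (𝓡 b) (𝓡 b) (fun v => act v h) u ξ) = Ad ((h : G)⁻¹) (omega u ξ)
  /-- `ω(ζ_X) = X` for the fundamental vector field `ζ_X(u) = d/dt|₀ u · exp(tX)`, `X ∈ T₁P` -/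
  omega_fundamental : ∀ (u : B) (X : TangentSpace (𝓡 p) (1 : P)),
    omega (act u 1) (mfderiv (𝓡 p) (𝓡 b) (fun h : P => act u h) 1 X) =
      mfderiv (𝓡 p) (𝓡 n) (Subtype.val : P → G) 1 X
  bijective_omega : ∀ u : B, Function.Bijective (omega u)

end Cartan

/-! ### The homogeneous model -/

section HomogeneousModel

lemma exists_local_section {k m : ℕ}
    {N : Type*} [TopologicalSpace N] [ChartedSpace (EuclideanSpace ℝ (Fin k)) N]
    {M : Type*} [TopologicalSpace M] [ChartedSpace (EuclideanSpace ℝ (Fin m)) M]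
    {q : N → M} (hq : Manifold.IsSubmersion (𝓡 k) (𝓡 m) ∞ q) (u : N) :
    ∃ (U : Set M) (σ : M → N), IsOpen U ∧ q u ∈ U ∧ ContMDiffOn (𝓡 m) (𝓡 k) ∞ σ U ∧
      ∀ y ∈ U, q (σ y) = y := by
  have h := hq.isSubmersionAt u
  let c : h.complement := (h.equiv (h.domChart u)).2
  let f : M → EuclideanSpace ℝ (Fin k) := fun y => h.equiv.symm (h.codChart y, c)
  have hf : ContMDiffOn (𝓡 m) (𝓡 k) ∞ f h.codChart.source := by
    have h1 : ContMDiffOn (𝓡 m) (𝓡 m) ∞ h.codChart h.codChart.source :=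
      contMDiffOn_of_mem_maximalAtlas h.codChart_mem_maximalAtlas
    have h2 : ContDiff ℝ ∞ (fun z : EuclideanSpace ℝ (Fin m) => h.equiv.symm (z, c)) := by
      fun_prop
    exact h2.contMDiff.comp_contMDiffOn h1
  have hU : IsOpen (h.codChart.source ∩ f ⁻¹' h.domChart.target) :=
    hf.continuousOn.isOpen_inter_preimage h.codChart.open_source h.domChart.open_target
  have hw : ∀ z ∈ h.domChart.target, h.codChart (q (h.domChart.symm z)) = (h.equiv z).1 := by
    intro z hz
    have hz' : z ∈ (h.domChart.extend (𝓡 k)).target := by simpa using hz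
    have := h.writtenInCharts hz'
    simpa using this
  refine ⟨_, fun y => h.domChart.symm (f y), hU, ⟨h.mem_codChart_source, ?_⟩, ?_, ?_⟩
  · have h3 : h.codChart (q u) = (h.equiv (h.domChart u)).1 := by
      have := hw _ (h.domChart.map_source h.mem_domChart_source)
      rwa [h.domChart.left_inv h.mem_domChart_source] at this
    have h4 : f (q u) = h.domChart u := by
      simp only [f, h3, c, Prod.mk.eta, ContinuousLinearEquiv.symm_apply_apply]
    simp only [Set.mem_preimage, h4]
    exact h.domChart.map_source h.mem_domChart_source
  · exact (contMDiffOn_symm_of_mem_maximalAtlas h.domChart_mem_maximalAtlas).comp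
      (hf.mono Set.inter_subset_left) (fun y hy => hy.2)
  · rintro y ⟨hy, hy'⟩
    have h5 := hw _ hy'
    simp only [f, ContinuousLinearEquiv.apply_symm_apply] at h5
    refine h.codChart.injOn ?_ hy h5
    exact h.source_subset_preimage_source (h.domChart.map_target hy')

variable {n p m : ℕ} {G : Type*} [Group G] [TopologicalSpace G]
  [ChartedSpace (EuclideanSpace ℝ (Fin n)) G] [LieGroup (𝓡 n) ∞ G]

lemma maurerCartan_injective (g : G) : Function.Injective (maurerCartan (n := n) g) := by
  have h1 : (fun x : G => g * x) ∘ (fun x => g⁻¹ * x) = id := by ext; simp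
  have hd : ∀ a b : G, MDifferentiableAt (𝓡 n) (𝓡 n) (fun x : G => a * x) b := fun a b =>
    (contMDiff_mul_left (I := 𝓡 n) (n := ∞) (a := a)).mdifferentiableAt (by simp)
  have h2 := mfderiv_comp (I := 𝓡 n) (I' := 𝓡 n) (I'' := 𝓡 n) g (hd g _) (hd g⁻¹ g)
  rw [h1, mfderiv_id] at h2
  intro v w hvw
  have h3 : ∀ v : TangentSpace (𝓡 n) g, v = mfderiv (𝓡 n) (𝓡 n) (fun x : G => g * x) (g⁻¹ * g)
      (mfderiv (𝓡 n) (𝓡 n) (fun x : G => g⁻¹ * x) g v) := fun v =>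
    congrArg (fun L : EuclideanSpace ℝ (Fin n) →L[ℝ] EuclideanSpace ℝ (Fin n) => L v) h2
  have h4 : mfderiv (𝓡 n) (𝓡 n) (fun x : G => g⁻¹ * x) g v =
    mfderiv (𝓡 n) (𝓡 n) (fun x : G => g⁻¹ * x) g w := hvw
  exact (h3 v).trans ((congrArg _ h4).trans (h3 w).symm)

lemma maurerCartan_bijective (g : G) : Function.Bijective (maurerCartan (n := n) g) := by
  refine ⟨maurerCartan_injective g, ?_⟩
  let L : EuclideanSpace ℝ (Fin n) →ₗ[ℝ] EuclideanSpace ℝ (Fin n) :=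
    (maurerCartan (n := n) g).toLinearMap
  exact (LinearMap.injective_iff_surjective (f := L)).1 (maurerCartan_injective g)

lemma maurerCartan_equivariant (h g : G) (ξ : TangentSpace (𝓡 n) g) :
    maurerCartan (g * h) (mfderiv (𝓡 n) (𝓡 n) (fun v => v * h) g ξ) =
      Ad h⁻¹ (maurerCartan g ξ) := by
  have hl : ∀ a b : G, MDifferentiableAt (𝓡 n) (𝓡 n) (fun x : G => a * x) b := fun a b =>
    (contMDiff_mul_left (I := 𝓡 n) (n := ∞) (a := a)).mdifferentiableAt (by simp)
  have hr : ∀ a b : G, MDifferentiableAt (𝓡 n) (𝓡 n) (fun x : G => x * a) b := fun a b =>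
    (contMDiff_mul_right (I := 𝓡 n) (n := ∞) (a := a)).mdifferentiableAt (by simp)
  have hc : ∀ b : G, MDifferentiableAt (𝓡 n) (𝓡 n) (fun x : G => h⁻¹ * x * h⁻¹⁻¹) b := fun b =>
    MDifferentiableAt.comp (I' := 𝓡 n) b (hr h⁻¹⁻¹ _) (hl h⁻¹ b)
  have h1 : (fun x : G => (g * h)⁻¹ * x) ∘ (fun v => v * h) =
      (fun x : G => h⁻¹ * x * h⁻¹⁻¹) ∘ (fun x => g⁻¹ * x) := by
    ext x; simp [mul_assoc]
  have h2 := mfderiv_comp (I := 𝓡 n) (I' := 𝓡 n) (I'' := 𝓡 n) g (hl (g * h)⁻¹ _) (hr h g)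
  have h3 := mfderiv_comp (I := 𝓡 n) (I' := 𝓡 n) (I'' := 𝓡 n) g (hc _) (hl g⁻¹ g)
  have h4 : ∀ (y : G) (_ : y = 1) (v : EuclideanSpace ℝ (Fin n)),
      (mfderiv (𝓡 n) (𝓡 n) (fun x : G => h⁻¹ * x * h⁻¹⁻¹) y v : EuclideanSpace ℝ (Fin n)) =
        Ad (n := n) h⁻¹ v := by
    rintro y rfl v; rfl
  have h5 : (mfderiv (𝓡 n) (𝓡 n) ((fun x : G => (g * h)⁻¹ * x) ∘ (fun v => v * h)) g ξ :
      EuclideanSpace ℝ (Fin n)) = mfderiv (𝓡 n) (𝓡 n)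
        ((fun x : G => h⁻¹ * x * h⁻¹⁻¹) ∘ (fun x => g⁻¹ * x)) g ξ := by rw [h1]
  rw [h2, h3] at h5
  exact h5.trans (h4 _ (inv_mul_cancel g) _)

lemma contMDiff_maurerCartan : ContMDiff (M' := EuclideanSpace ℝ (Fin n)) (𝓡 n).tangent (𝓡 n) ∞
    (fun v : TangentBundle (𝓡 n) G => maurerCartan v.proj v.2) := by
  let F₁ : TangentBundle (𝓡 n) G → TangentBundle (𝓡 n) G × TangentBundle (𝓡 n) G :=
    fun v => (Bundle.TotalSpace.mk' _ v.proj⁻¹ 0, v)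
  have hp : ContMDiff (𝓡 n).tangent (𝓡 n) ∞ (fun v : TangentBundle (𝓡 n) G => v.proj⁻¹) :=
    (contMDiff_inv (𝓡 n) ∞).comp (Bundle.contMDiff_proj _)
  have S₁ : ContMDiff (𝓡 n).tangent ((𝓡 n).tangent.prod (𝓡 n).tangent) ∞ F₁ := by
    refine ContMDiff.prodMk ?_ contMDiff_id
    exact (Bundle.contMDiff_zeroSection ℝ (TangentSpace (𝓡 n) : G → Type _)).comp hp
  let F₂ : (TangentBundle (𝓡 n) G × TangentBundle (𝓡 n) G) →
      TangentBundle ((𝓡 n).prod (𝓡 n)) (G × G) := (equivTangentBundleProd (𝓡 n) G (𝓡 n) G).symm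
  have S₂ : ContMDiff ((𝓡 n).tangent.prod (𝓡 n).tangent) ((𝓡 n).prod (𝓡 n)).tangent ∞ F₂ :=
    contMDiff_equivTangentBundleProd_symm
  let F₃ : TangentBundle ((𝓡 n).prod (𝓡 n)) (G × G) → TangentBundle (𝓡 n) G :=
    tangentMap ((𝓡 n).prod (𝓡 n)) (𝓡 n) (fun a : G × G => a.1 * a.2)
  have S₃ : ContMDiff ((𝓡 n).prod (𝓡 n)).tangent (𝓡 n).tangent ∞ F₃ :=
    ContMDiff.contMDiff_tangentMap (n := ∞) (contMDiff_mul (𝓡 n) ∞) le_rfl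
  have S := (S₃.comp S₂).comp S₁
  have hS : ∀ v, (F₃ ∘ F₂) (F₁ v) =
      (⟨v.proj⁻¹ * v.proj, maurerCartan v.proj v.2⟩ : TangentBundle (𝓡 n) G) := by
    rintro ⟨g, ξ⟩
    simp only [Function.comp_apply, tangentMap, F₃, F₂, F₁]
    rw [mfderiv_prod_eq_add_apply ((contMDiff_mul (𝓡 n) ∞).mdifferentiableAt (by simp))]
    simp +instances [maurerCartan]
    refine congrArg (Bundle.TotalSpace.mk' (EuclideanSpace ℝ (Fin n)) (g⁻¹ * g)) ?_
    have h0 : ∀ (L : EuclideanSpace ℝ (Fin n) →L[ℝ] EuclideanSpace ℝ (Fin n))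
        (w : EuclideanSpace ℝ (Fin n)), L 0 + w = w := fun L w => by rw [map_zero, zero_add]
    exact h0 _ _
  intro v₀
  have h := (Bundle.contMDiffAt_totalSpace.1 (S v₀)).2
  refine h.congr_of_eventuallyEq (Filter.Eventually.of_forall fun v => ?_)
  simp only [Function.comp_apply] at hS ⊢
  rw [hS, hS]
  have h1 : ∀ (y y₀ : G) (_ : y = 1) (_ : y₀ = 1) (w : EuclideanSpace ℝ (Fin n)),
      w = (trivializationAt (EuclideanSpace ℝ (Fin n)) (TangentSpace (𝓡 n) : G → Type _) y₀
        (⟨y, w⟩ : TangentBundle (𝓡 n) G)).2 := by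
    rintro y y₀ rfl rfl w
    exact (tangentCoordChange_self (I := 𝓡 n) (x := (1 : G)) (z := 1) (v := w)
      (mem_extChartAt_source (I := 𝓡 n) (1 : G))).symm
  exact h1 _ _ (inv_mul_cancel _) (inv_mul_cancel _) _

variable (P : Subgroup G) [ChartedSpace (EuclideanSpace ℝ (Fin p)) P]
  [ChartedSpace (EuclideanSpace ℝ (Fin m)) (G ⧸ P)]

lemma contMDiff_mul_subgroup
    (hP : Manifold.IsSmoothEmbedding (𝓡 p) (𝓡 n) ∞ (Subtype.val : P → G)) :
    ContMDiff ((𝓡 n).prod (𝓡 p)) (𝓡 n) ∞ (fun v : G × P => v.1 * (v.2 : G)) :=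
  contMDiff_fst.mul (hP.contMDiff.comp contMDiff_snd)

lemma maurerCartan_fundamental
    (hP : Manifold.IsSmoothEmbedding (𝓡 p) (𝓡 n) ∞ (Subtype.val : P → G))
    (g : G) (X : TangentSpace (𝓡 p) (1 : P)) :
    maurerCartan (g * ((1 : P) : G)) (mfderiv (𝓡 p) (𝓡 n) (fun h : P => g * (h : G)) 1 X) =
      mfderiv (𝓡 p) (𝓡 n) (Subtype.val : P → G) 1 X := by
  have hl : ∀ a b : G, MDifferentiableAt (𝓡 n) (𝓡 n) (fun x : G => a * x) b := fun a b =>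
    (contMDiff_mul_left (I := 𝓡 n) (n := ∞) (a := a)).mdifferentiableAt (by simp)
  have hv : MDifferentiableAt (𝓡 p) (𝓡 n) (Subtype.val : P → G) 1 :=
    hP.contMDiff.mdifferentiableAt (by simp)
  have hgv : MDifferentiableAt (𝓡 p) (𝓡 n) (fun h : P => g * (h : G)) 1 :=
    MDifferentiableAt.comp (I' := 𝓡 n) (1 : P) (hl g _) hv
  have h1 : (fun x : G => (g * ((1 : P) : G))⁻¹ * x) ∘ (fun h : P => g * (h : G)) =
      (Subtype.val : P → G) := by
    ext x; simp
  have h2 := mfderiv_comp (I := 𝓡 p) (I' := 𝓡 n) (I'' := 𝓡 n) (1 : P)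
    (hl (g * ((1 : P) : G))⁻¹ _) hgv
  rw [h1] at h2
  exact (congrArg (fun L : EuclideanSpace ℝ (Fin p) →L[ℝ] EuclideanSpace ℝ (Fin n) => L X) h2).symm

lemma exists_trivialization
    (hP : Manifold.IsSmoothEmbedding (𝓡 p) (𝓡 n) ∞ (Subtype.val : P → G))
    (hq : Manifold.IsSubmersion (𝓡 n) (𝓡 m) ∞ (QuotientGroup.mk : G → G ⧸ P)) (x : G ⧸ P) :
    ∃ e : Bundle.Trivialization P (QuotientGroup.mk : G → G ⧸ P), x ∈ e.baseSet ∧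
    ContMDiffOn (𝓡 n) ((𝓡 m).prod (𝓡 p)) ∞ e e.source ∧
    ContMDiffOn ((𝓡 m).prod (𝓡 p)) (𝓡 n) ∞ e.toOpenPartialHomeomorph.symm e.target ∧
    ∀ u ∈ e.source, ∀ h : P, e (u * h) = ((e u).1, (e u).2 * h) := by
  classical
  obtain ⟨g, rfl⟩ := QuotientGroup.mk_surjective x
  obtain ⟨U, σ, hU, hgU, hσ, hqσ⟩ := exists_local_section hq g
  have hqc : Continuous (QuotientGroup.mk : G → G ⧸ P) := hq.contMDiff.continuous
  have hmem : ∀ u : G, (u : G ⧸ P) ∈ U → (σ u)⁻¹ * u ∈ P := fun u hu =>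
    QuotientGroup.eq.1 (hqσ u hu)
  let τ : G → P := fun u => if h : (σ u)⁻¹ * u ∈ P then ⟨(σ u)⁻¹ * u, h⟩ else 1
  have hτ : ∀ u : G, (u : G ⧸ P) ∈ U → (τ u : G) = (σ u)⁻¹ * u := fun u hu => by
    simp only [τ, dif_pos (hmem u hu)]
  have hopen : IsOpen ((QuotientGroup.mk : G → G ⧸ P) ⁻¹' U) := hU.preimage hqc
  have hval : ContMDiffOn (𝓡 n) (𝓡 n) ∞ (fun u => (τ u : G))
      ((QuotientGroup.mk : G → G ⧸ P) ⁻¹' U) := by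
    have h1 : ContMDiffOn (𝓡 n) (𝓡 n) ∞ (fun u : G => (σ u)⁻¹ * u)
        ((QuotientGroup.mk : G → G ⧸ P) ⁻¹' U) :=
      ((hσ.comp hq.contMDiff.contMDiffOn (fun u hu => hu)).inv).mul contMDiffOn_id
    exact h1.congr hτ
  have hτs : ContMDiffOn (𝓡 n) (𝓡 p) ∞ τ ((QuotientGroup.mk : G → G ⧸ P) ⁻¹' U) := by
    have hc : ContinuousOn τ ((QuotientGroup.mk : G → G ⧸ P) ⁻¹' U) :=
      hP.isEmbedding.isInducing.continuousOn_iff.2 hval.continuousOn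
    intro u hu
    refine ContMDiffAt.contMDiffWithinAt ?_
    exact (ContMDiffAt.iff_comp_isImmersionAt (hP.isImmersion.isImmersionAt _)).2
      ⟨hc.continuousAt (hopen.mem_nhds hu), hval.contMDiffAt (hopen.mem_nhds hu)⟩
  have hto : ContMDiffOn (𝓡 n) ((𝓡 m).prod (𝓡 p)) ∞ (fun u : G => ((u : G ⧸ P), τ u))
      ((QuotientGroup.mk : G → G ⧸ P) ⁻¹' U) := hq.contMDiff.contMDiffOn.prodMk hτs
  have hinv : ContMDiffOn ((𝓡 m).prod (𝓡 p)) (𝓡 n) ∞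
      (fun v : (G ⧸ P) × P => σ v.1 * (v.2 : G)) (U ×ˢ Set.univ) :=
    (hσ.comp contMDiffOn_fst (fun v hv => hv.1)).mul
      (hP.contMDiff.comp contMDiff_snd).contMDiffOn
  have hmk : ∀ (y : G ⧸ P), y ∈ U → ∀ h : P, ((σ y * h : G) : G ⧸ P) = y := fun y hy h => by
    rw [QuotientGroup.mk_mul_of_mem _ h.2, hqσ y hy]
  let e : Bundle.Trivialization P (QuotientGroup.mk : G → G ⧸ P) :=
    { toFun := fun u => ((u : G ⧸ P), τ u)
      invFun := fun v => σ v.1 * (v.2 : G)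
      source := (QuotientGroup.mk : G → G ⧸ P) ⁻¹' U
      target := U ×ˢ Set.univ
      map_source' := fun u hu => ⟨hu, trivial⟩
      map_target' := fun v hv => by
        rw [Set.mem_preimage, hmk v.1 hv.1 v.2]; exact hv.1
      left_inv' := fun u hu => by
        simp only [hτ u hu, mul_inv_cancel_left]
      right_inv' := fun v hv => by
        refine Prod.ext (hmk v.1 hv.1 v.2) (Subtype.ext ?_)
        have h1 := hτ (σ v.1 * (v.2 : G)) (by rw [hmk v.1 hv.1 v.2]; exact hv.1)
        rw [h1, hmk v.1 hv.1 v.2, inv_mul_cancel_left]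
      open_source := hopen
      open_target := hU.prod isOpen_univ
      continuousOn_toFun := hto.continuousOn
      continuousOn_invFun := hinv.continuousOn
      baseSet := U
      open_baseSet := hU
      source_eq := rfl
      target_eq := rfl
      proj_toFun := fun _ _ => rfl }
  refine ⟨e, hgU, hto, hinv, fun u hu h => ?_⟩
  have h1 : ((u * h : G) : G ⧸ P) = u := QuotientGroup.mk_mul_of_mem _ h.2
  refine Prod.ext h1 (Subtype.ext ?_)
  change (τ (u * h) : G) = (τ u : G) * h
  rw [hτ _ (by rw [h1]; exact hu), hτ u hu, h1, mul_assoc]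

variable [LieGroup (𝓡 p) ∞ P] [IsManifold (𝓡 m) ∞ (G ⧸ P)]

/-- The homogeneous model `(G → G/P, ω_G)`.  `P` is an embedded Lie subgroup of `G`, and `G/P`
carries its smooth structure as a homogeneous space, i.e. the (unique) one for which the projection
`G → G/P` is a smooth submersion. -/
noncomputable def homogeneousModel
    (hP : Manifold.IsSmoothEmbedding (𝓡 p) (𝓡 n) ∞ (Subtype.val : P → G))
    (hq : Manifold.IsSubmersion (𝓡 n) (𝓡 m) ∞ (QuotientGroup.mk : G → G ⧸ P)) :
    CartanGeometry n p n m P G (G ⧸ P) where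
  proj := QuotientGroup.mk
  act g h := g * h
  act_one g := mul_one g
  act_mul g h k := (mul_assoc g h k).symm
  contMDiff_act := contMDiff_mul_subgroup P hP
  proj_act g h := QuotientGroup.mk_mul_of_mem g h.2
  locallyTrivial := exists_trivialization P hP hq
  omega := maurerCartan
  contMDiff_omega := contMDiff_maurerCartan
  omega_equivariant h g ξ := maurerCartan_equivariant (h : G) g ξ
  omega_fundamental g X := maurerCartan_fundamental P hP g X
  bijective_omega := maurerCartan_bijective

end HomogeneousModel

section Symmetries

variable {n p b m : ℕ} {G : Type*} [Group G] [TopologicalSpace G]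
  [ChartedSpace (EuclideanSpace ℝ (Fin n)) G] [LieGroup (𝓡 n) ∞ G]
  {P : Subgroup G} [ChartedSpace (EuclideanSpace ℝ (Fin p)) P] [LieGroup (𝓡 p) ∞ P]
  {B : Type*} [TopologicalSpace B] [ChartedSpace (EuclideanSpace ℝ (Fin b)) B]
  [IsManifold (𝓡 b) ∞ B]
  {M : Type*} [TopologicalSpace M] [ChartedSpace (EuclideanSpace ℝ (Fin m)) M]
  [IsManifold (𝓡 m) ∞ M]
  (C : CartanGeometry n p b m P B M)

namespace CartanGeometry

/-- `φ` is an automorphism of the Cartan geometry `C` defined over `U ⊆ M`: a `P`-equivariant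
diffeomorphism from `proj⁻¹(U)` onto an open subset of the total space, with `φ^* ω = ω`. -/
structure IsLocalAutomorphism (U : Set M) (φ : PartialDiffeomorph (𝓡 b) (𝓡 b) B B ∞) :
    Prop where
  source_eq : φ.source = C.proj ⁻¹' U
  equivariant : ∀ u ∈ C.proj ⁻¹' U, ∀ h : P, φ (C.act u h) = C.act (φ u) h
  pullback_omega : ∀ u ∈ C.proj ⁻¹' U, ∀ ξ : TangentSpace (𝓡 b) u,
    C.omega (φ u) (mfderiv (𝓡 b) (𝓡 b) φ u ξ) = C.omega u ξ

/-- The local diffeomorphism `s` of `M` is a symmetry with center `x` which, on the open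
neighborhood `U` of `x`, is covered by an automorphism of the Cartan geometry. -/
structure IsSymmetryOn (x : M) (U : Set M) (s : PartialDiffeomorph (𝓡 m) (𝓡 m) M M ∞) :
    Prop where
  isOpen : IsOpen U
  mem : x ∈ U
  subset_source : U ⊆ s.source
  map_center : s x = x
  mfderiv_center : ∀ v : EuclideanSpace ℝ (Fin m),
    (mfderiv (𝓡 m) (𝓡 m) s x v : EuclideanSpace ℝ (Fin m)) = -v
  covered : ∃ φ : PartialDiffeomorph (𝓡 b) (𝓡 b) B B ∞,
    C.IsLocalAutomorphism U φ ∧ ∀ u ∈ C.proj ⁻¹' U, C.proj (φ u) = s (C.proj u)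

/-- `s` is a (local) symmetry with center `x` of a `|1|`-graded geometry. -/
def IsSymmetryAt (x : M) (s : PartialDiffeomorph (𝓡 m) (𝓡 m) M M ∞) : Prop :=
  ∃ U : Set M, C.IsSymmetryOn x U s

/-- The geometry is (locally) symmetric: there is a symmetry at each point. -/
def IsSymmetric : Prop :=
  ∀ x : M, ∃ s : PartialDiffeomorph (𝓡 m) (𝓡 m) M M ∞, C.IsSymmetryAt x s

/-- The germs at `x` of the symmetries with center `x`. -/
def symmetryGerms (x : M) : Set (Filter.Germ (𝓝 x) M) :=
  {γ | ∃ s : PartialDiffeomorph (𝓡 m) (𝓡 m) M M ∞,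
    C.IsSymmetryAt x s ∧ γ = ((s : M → M) : Filter.Germ (𝓝 x) M)}

end CartanGeometry

end Symmetries

end ParabolicGeometry

open ParabolicGeometry

/-! Let `φ` be an automorphism of a Cartan geometry covering a symmetry with center `x`, and let `u`
lie over `x`. Then `φ u = u · h` with `h ∈ P`, and `φ` followed by right translation by `h⁻¹` fixes
`u`. Since `φ` preserves `ω` and `ω` is equivariant, `ω` turns the differential of this map at `u`
into `Ad h`. The vertical space is `ω⁻¹(𝔭)`, so differential `-id` at `x` forces `Ad h` to be `-id`
modulo `𝔭` (`actsAsNegId_of_covers`). This is (3), and it produces the element needed in (1). The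
same computation on `G/P`, read backwards, shows that conjugates `a k a⁻¹` of such elements give
symmetries at `aP` (`isSymmetryOn_of_eq_smul`).

The rest of (1) is rigidity: if `φ` preserves the Maurer-Cartan form, then `φ(v) v⁻¹` has zero
differential, so it is locally constant (`eventually_eq_mul_of_pullback_maurerCartan`). Equivariance
makes it constant on fibers, so it descends to `U`, and connectedness of `U` suffices.

For the infinitude in (2), conjugate one such `g` by all `b ∈ P`. If only finitely many germs arose,
Baire's theorem would make some conjugate commute, near the origin of `G/P`, with all elements of
`P` near the unit. Writing `g` for this conjugate and differentiating, `Ad x (Ad g⁻¹ A - A) ∈ 𝔭` for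
`A ∈ 𝔭` and `x` near `1`. Vectors whose local orbit stays in `𝔭` form an ideal inside `𝔭`, which
vanishes (`eq_zero_of_eventually_Ad_mem`), so `Ad g⁻¹` is the identity on `𝔭`. Being `-id` modulo
`𝔭` as well, it would make `𝔤₋₁` an abelian ideal (`not_neg_of_id_on_filt_zero`). This uses that
`Ad` acts by Lie algebra homomorphisms and has derivative `ad`. -/

namespace ParabolicGeometry

/-! ### Algebra of the grading and its ideals -/

namespace OneGrading

variable {𝔤 : Type*} [LieRing 𝔤] [LieAlgebra ℝ 𝔤] (D : OneGrading 𝔤)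

lemma proj_add (i : ℤ) (X Y : 𝔤) : D.proj i (X + Y) = D.proj i X + D.proj i Y := by
  let _ := D.isInternal.chooseDecomposition
  simp [proj, DirectSum.decompose_add]

lemma proj_of_mem {i : ℤ} {X : 𝔤} (hX : X ∈ D.gr i) : D.proj i X = X := by
  let _ := D.isInternal.chooseDecomposition
  exact DirectSum.decompose_of_mem_same D.gr hX

lemma proj_of_mem_ne {i j : ℤ} (hij : i ≠ j) {X : 𝔤} (hX : X ∈ D.gr i) : D.proj j X = 0 := by
  let _ := D.isInternal.chooseDecomposition
  exact DirectSum.decompose_of_mem_ne D.gr hX hij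

lemma eq_zero_of_mem_of_mem {i j : ℤ} (hij : i ≠ j) {X : 𝔤} (hi : X ∈ D.gr i)
    (hj : X ∈ D.gr j) : X = 0 := by
  rw [← D.proj_of_mem hj, D.proj_of_mem_ne hij hi]

lemma gr_le_filt {i j : ℤ} (hij : i ≤ j) : D.gr j ≤ D.filt i :=
  le_iSup₂_of_le (f := fun j (_ : i ≤ j) => D.gr j) j hij le_rfl

lemma gr_le_one {j : ℤ} (hj : 1 ≤ j) : D.gr j ≤ D.gr 1 := by
  rcases hj.eq_or_lt with rfl | h
  · exact le_rfl
  · rw [D.gr_eq_bot j (by rwa [abs_of_pos (by omega)])]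
    exact bot_le

lemma filt_zero : D.filt 0 = D.gr 0 ⊔ D.gr 1 := by
  refine le_antisymm (iSup₂_le fun j hj => ?_)
    (sup_le (D.gr_le_filt le_rfl) (D.gr_le_filt zero_le_one))
  rcases hj.eq_or_lt with rfl | h
  · exact le_sup_left
  · exact (D.gr_le_one h).trans le_sup_right

lemma exists_add_of_mem_filt_zero {X : 𝔤} (hX : X ∈ D.filt 0) :
    ∃ X₀ ∈ D.gr 0, ∃ X₁ ∈ D.gr 1, X₀ + X₁ = X := by
  rwa [filt_zero, Submodule.mem_sup] at hX

lemma exists_add (X : 𝔤) : ∃ Y ∈ D.gr (-1), ∃ Z ∈ D.filt 0, Y + Z = X := by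
  have h : X ∈ ⨆ i, D.gr i := by
    rw [D.isInternal.submodule_iSup_eq_top]; trivial
  have h2 : (⨆ i, D.gr i) ≤ D.gr (-1) ⊔ D.filt 0 := by
    refine iSup_le fun i => ?_
    rcases lt_trichotomy i (-1) with hi | rfl | hi
    · rw [D.gr_eq_bot i (by rw [abs_of_neg (by omega)]; omega)]
      exact bot_le
    · exact le_sup_left
    · exact (D.gr_le_filt (by omega)).trans le_sup_right
  exact Submodule.mem_sup.1 (h2 h)

lemma mem_filt_zero_iff {X : 𝔤} : X ∈ D.filt 0 ↔ D.proj (-1) X = 0 := by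
  constructor
  · intro hX
    obtain ⟨X₀, h₀, X₁, h₁, rfl⟩ := D.exists_add_of_mem_filt_zero hX
    rw [proj_add, D.proj_of_mem_ne (by decide) h₀, D.proj_of_mem_ne (by decide) h₁, add_zero]
  · intro h
    obtain ⟨Y, hY, Z, hZ, rfl⟩ := D.exists_add X
    have hZ' : D.proj (-1) Z = 0 := by
      obtain ⟨X₀, h₀, X₁, h₁, rfl⟩ := D.exists_add_of_mem_filt_zero hZ
      rw [proj_add, D.proj_of_mem_ne (by decide) h₀, D.proj_of_mem_ne (by decide) h₁, add_zero]
    rw [proj_add, D.proj_of_mem hY, hZ', add_zero] at h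
    rwa [h, zero_add]

lemma lie_eq_zero_of_lt {i j : ℤ} (hij : 1 < |i + j|) {X Y : 𝔤} (hX : X ∈ D.gr i)
    (hY : Y ∈ D.gr j) : ⁅X, Y⁆ = 0 := by
  have h := D.lie_mem i j X hX Y hY
  rwa [D.gr_eq_bot _ hij, Submodule.mem_bot] at h

/-- In a semisimple Lie algebra, `𝔭` contains no nonzero ideal. -/
theorem eq_bot_of_le_filt_zero [LieAlgebra.IsSemisimple ℝ 𝔤] (K : LieIdeal ℝ 𝔤)
    (hK : K.toSubmodule ≤ D.filt 0) : K = ⊥ := by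
  -- Ideals of a semisimple algebra form a complemented lattice, so a nonzero `K` would contain a
  -- minimal ideal `J`, which is simple.
  have hat : IsAtomic (LieIdeal ℝ 𝔤) :=
    haveI : ComplementedLattice (LieIdeal ℝ 𝔤) :=
      (LieAlgebra.IsSemisimple.booleanGenerators ℝ 𝔤).complementedLattice_of_sSup_eq_top
        LieAlgebra.IsSemisimple.sSup_atoms_eq_top
    inferInstance
  refine (IsAtomic.eq_bot_or_exists_atom_le K).resolve_right ?_
  rintro ⟨J, hJ, hJK⟩
  have hJp : ∀ Y ∈ J, Y ∈ D.filt 0 := fun Y hY => hK (hJK hY)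
  have hsimple : LieAlgebra.IsSimple ℝ J := LieAlgebra.IsSemisimple.isSimple_of_isAtom J hJ
  have hna := LieAlgebra.IsSemisimple.non_abelian_of_isAtom J hJ
  -- As `J ≤ 𝔭`, bracketing with `J` preserves `𝔤₁`, so `J ∩ 𝔤₁` is an ideal of the simple algebra
  -- `J`. It is not all of `J`, because `𝔤₁` is abelian.
  have h1 : ∀ Z ∈ J, Z ∈ D.gr 1 → Z = 0 := by
    let I : LieIdeal ℝ J :=
      { carrier := {Z | (Z : 𝔤) ∈ D.gr 1}
        add_mem' := fun {a b} ha hb => (D.gr 1).add_mem ha hb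
        zero_mem' := (D.gr 1).zero_mem
        smul_mem' := fun c a ha => (D.gr 1).smul_mem c ha
        lie_mem := fun {x m} hm => by
          obtain ⟨X₀, h₀, X₁, h₁, hX⟩ := D.exists_add_of_mem_filt_zero (hJp x x.2)
          change ⁅(x : 𝔤), (m : 𝔤)⁆ ∈ D.gr 1
          rw [← hX, add_lie, D.lie_eq_zero_of_lt (i := 1) (j := 1) (by decide) h₁ hm, add_zero]
          simpa using D.lie_mem 0 1 _ h₀ _ hm }
    have hmem : ∀ Z : J, Z ∈ I ↔ (Z : 𝔤) ∈ D.gr 1 := fun Z => Iff.rfl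
    rcases hsimple.eq_bot_or_eq_top I with h | h
    · intro Z hZ hZ1
      have h2 : (⟨Z, hZ⟩ : J) ∈ I := hZ1
      rw [h, LieSubmodule.mem_bot] at h2
      exact congrArg Subtype.val h2
    · refine (hna ⟨fun x y => Subtype.ext ?_⟩).elim
      have hx : x ∈ I := by rw [h]; trivial
      have hy : y ∈ I := by rw [h]; trivial
      exact D.lie_eq_zero_of_lt (i := 1) (j := 1) (by decide) hx hy
  have h2 : ∀ Z ∈ D.gr 1, ∀ Y₀ ∈ D.gr 0, ∀ Y₁ ∈ D.gr 1, Y₀ + Y₁ ∈ J → ⁅Z, Y₀⁆ = 0 := by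
    intro Z hZ Y₀ h₀ Y₁ h₁ hY
    have h3 : ⁅Z, Y₀⁆ = ⁅Z, Y₀ + Y₁⁆ := by
      rw [lie_add, D.lie_eq_zero_of_lt (i := 1) (j := 1) (by decide) hZ h₁, add_zero]
    refine h1 _ ?_ (by simpa using D.lie_mem 1 0 _ hZ _ h₀)
    rw [h3]
    exact lie_mem_right ℝ 𝔤 J Z _ hY
  have h3 : ∀ Y ∈ J, ∀ Y' ∈ J, ⁅Y, Y'⁆ ∈ D.gr 0 := by
    intro Y hY Y' hY'
    obtain ⟨X₀, h₀, X₁, h₁, rfl⟩ := D.exists_add_of_mem_filt_zero (hJp Y hY)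
    obtain ⟨X₀', h₀', X₁', h₁', rfl⟩ := D.exists_add_of_mem_filt_zero (hJp Y' hY')
    rw [add_lie, lie_add, lie_add, h2 X₁ h₁ _ h₀' _ h₁' hY',
      D.lie_eq_zero_of_lt (i := 1) (j := 1) (by decide) h₁ h₁', ← lie_skew X₀ X₁',
      h2 X₁' h₁' _ h₀ _ h₁ hY]
    simpa using D.lie_mem 0 0 _ h₀ _ h₀'
  -- A minimal nonabelian ideal is perfect, so the inclusion `[J, J] ⊆ 𝔤₀` puts `J` itself in `𝔤₀`,
  -- which the grading forbids.
  have h4 : (⁅J, J⁆ : LieIdeal ℝ 𝔤) = J := by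
    refine (hJ.le_iff.1 (LieSubmodule.lie_le_right J J)).resolve_left fun h => hna ⟨fun x y => ?_⟩
    refine Subtype.ext ?_
    have h5 := LieSubmodule.lie_mem_lie x.2 y.2 (I := J) (N := J)
    rwa [h, LieSubmodule.mem_bot] at h5
  refine D.not_le_gr_zero J hsimple ?_
  rw [← h4, LieSubmodule.lieIdeal_oper_eq_linear_span', Submodule.span_le]
  rintro _ ⟨x, hx, y, hy, rfl⟩
  exact h3 x hx y hy

/-- No Lie algebra endomorphism is the identity on `𝔭` and `-id` modulo `𝔭` on `𝔤₋₁`. -/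
theorem not_neg_of_id_on_filt_zero [LieAlgebra.IsSemisimple ℝ 𝔤] (α : 𝔤 → 𝔤)
    (hlie : ∀ X Y, α ⁅X, Y⁆ = ⁅α X, α Y⁆) (hid : ∀ A ∈ D.filt 0, α A = A)
    (hneg : ∀ X ∈ D.gr (-1), α X + X ∈ D.filt 0) : False := by
  -- Since `α` fixes `Z` and `[X, Z]`, also `[α X, Z] = [X, Z]`. Hence `[α X + X, Z] = 2 [X, Z]`,
  -- with the left side in `𝔤₁` and the right side in `𝔤₀`.
  have h1 : ∀ X ∈ D.gr (-1), ∀ Z ∈ D.gr 1, ⁅X, Z⁆ = 0 := by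
    intro X hX Z hZ
    have h0 : ⁅X, Z⁆ ∈ D.gr 0 := by simpa using D.lie_mem (-1) 1 _ hX _ hZ
    have h2 : ⁅α X + X, Z⁆ ∈ D.gr 1 := by
      obtain ⟨X₀, h₀, X₁, h₁, hA⟩ := D.exists_add_of_mem_filt_zero (hneg X hX)
      rw [← hA, add_lie, D.lie_eq_zero_of_lt (i := 1) (j := 1) (by decide) h₁ hZ, add_zero]
      simpa using D.lie_mem 0 1 _ h₀ _ hZ
    have h3 : ⁅α X + X, Z⁆ = ⁅X, Z⁆ + ⁅X, Z⁆ := by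
      have h4 := hlie X Z
      rw [hid _ (D.gr_le_filt le_rfl h0), hid _ (D.gr_le_filt zero_le_one hZ)] at h4
      rw [add_lie, ← h4]
    have h5 := D.eq_zero_of_mem_of_mem (by decide) ((D.gr 0).add_mem h0 h0) (h3 ▸ h2)
    rw [← two_smul ℝ] at h5
    exact (smul_eq_zero.1 h5).resolve_left two_ne_zero
  let I : LieIdeal ℝ 𝔤 :=
    { D.gr (-1) with
      lie_mem := fun {Y X} (hX : X ∈ D.gr (-1)) => by
        change ⁅Y, X⁆ ∈ D.gr (-1)
        obtain ⟨Y', hY', Z, hZ, rfl⟩ := D.exists_add Y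
        obtain ⟨X₀, h₀, X₁, h₁, rfl⟩ := D.exists_add_of_mem_filt_zero hZ
        rw [add_lie, add_lie, D.lie_eq_zero_of_lt (i := -1) (j := -1) (by decide) hY' hX,
          ← lie_skew X₁ X, h1 X hX X₁ h₁]
        simpa using D.lie_mem 0 (-1) _ h₀ _ hX }
  have hI : I = ⊥ := by
    refine (LieAlgebra.hasTrivialRadical_iff_no_abelian_ideals ℝ 𝔤).1 inferInstance I
      ⟨fun x y => Subtype.ext ?_⟩
    exact D.lie_eq_zero_of_lt (i := -1) (j := -1) (by decide) x.2 y.2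
  exact D.gr_neg_one_ne_bot (congrArg LieSubmodule.toSubmodule hI)

end OneGrading

/-! ### Second-order calculus of a local multiplication -/

section LocalMultiplication

variable {E : Type*} [NormedAddCommGroup E] [NormedSpace ℝ E]

lemma hasFDerivAt_fderiv_apply {F : Type*} [NormedAddCommGroup F] [NormedSpace ℝ F] {μ : F → E}
    {z : F} (hμ : ContDiffAt ℝ 2 μ z) {i : E → F} {e : E} {L : E →L[ℝ] F}
    (hi : HasFDerivAt i L e) (hie : i e = z) {B : E → F} {B' : E →L[ℝ] F}
    (hB : HasFDerivAt B B' e) (X : E) :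
    fderiv ℝ (fun a => fderiv ℝ μ (i a) (B a)) e X =
      fderiv ℝ (fderiv ℝ μ) z (L X) (B e) + fderiv ℝ μ z (B' X) := by
  have h1 : HasFDerivAt (fderiv ℝ μ) (fderiv ℝ (fderiv ℝ μ) z) (i e) := by
    rw [hie]
    exact ((hμ.fderiv_right (m := 1) (by norm_num)).differentiableAt (by simp)).hasFDerivAt
  have h2 := (h1.comp e hi).clm_apply hB
  have h3 := congrArg (fun M : E →L[ℝ] E => M X) h2.fderiv
  simp only [Function.comp_apply, hie] at h3
  refine h3.trans ?_
  simp [add_comm]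

/-- For a local multiplication `μ` with unit `e`, the derivative at `e` of the adjoint action is
the Lie bracket of the left invariant vector fields. -/
lemma fderiv_adjoint_eq_lieBracket {μ : E × E → E} {e : E} (hμ : ContDiffAt ℝ 2 μ (e, e))
    (hl : ∀ᶠ b in 𝓝 e, μ (e, b) = b) (hr : ∀ᶠ a in 𝓝 e, μ (a, e) = a)
    {B : E → E} (hB : DifferentiableAt ℝ B e) (X Y : E) (hBe : B e = Y)
    (h : ∀ᶠ a in 𝓝 e, fderiv ℝ μ (a, e) (0, Y) = fderiv ℝ μ (e, a) (B a, 0)) :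
    fderiv ℝ B e X = VectorField.lieBracket ℝ (fun a => fderiv ℝ μ (a, e) (0, X))
      (fun a => fderiv ℝ μ (a, e) (0, Y)) e := by
  have hd : DifferentiableAt ℝ μ (e, e) := hμ.differentiableAt (by simp)
  have hi1 : HasFDerivAt (fun a : E => (a, e)) (ContinuousLinearMap.inl ℝ E E) e :=
    hasFDerivAt_prodMk_left e e
  have hi2 : HasFDerivAt (fun a : E => (e, a)) (ContinuousLinearMap.inr ℝ E E) e :=
    hasFDerivAt_prodMk_right e e
  have hD1 : ∀ Z : E, fderiv ℝ μ (e, e) (Z, 0) = Z := by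
    intro Z
    have h1 := HasFDerivAt.comp e (f := fun a : E => (a, e)) (g := μ) hd.hasFDerivAt hi1
    have h2 := ((hasFDerivAt_id e).congr_of_eventuallyEq hr).unique h1
    simpa using (congrArg (fun M : E →L[ℝ] E => M Z) h2).symm
  have hD2 : ∀ Z : E, fderiv ℝ μ (e, e) (0, Z) = Z := by
    intro Z
    have h1 := HasFDerivAt.comp e (f := fun a : E => (e, a)) (g := μ) hd.hasFDerivAt hi2
    have h2 := ((hasFDerivAt_id e).congr_of_eventuallyEq hl).unique h1
    simpa using (congrArg (fun M : E →L[ℝ] E => M Z) h2).symm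
  have hL : ∀ Z W : E, fderiv ℝ (fun a => fderiv ℝ μ (a, e) (0, Z)) e W =
      fderiv ℝ (fderiv ℝ μ) (e, e) (W, 0) (0, Z) := by
    intro Z W
    rw [hasFDerivAt_fderiv_apply hμ hi1 rfl (hasFDerivAt_const (0, Z) e)]
    simp
  have hBp : HasFDerivAt (fun a => (B a, (0 : E))) ((fderiv ℝ B e).prod 0) e :=
    hB.hasFDerivAt.prodMk (hasFDerivAt_const 0 e)
  -- Differentiating both sides of `h` at `e` along `X` gives `D²μ((X,0),(0,Y)) = D²μ((0,X),(Y,0)) +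
  -- B' X`. By symmetry of `D²μ`, solving for `B' X` gives the bracket.
  have hR := hasFDerivAt_fderiv_apply hμ hi2 rfl hBp X
  have hLR : fderiv ℝ (fun a => fderiv ℝ μ (a, e) (0, Y)) e =
    fderiv ℝ (fun a => fderiv ℝ μ (e, a) (B a, 0)) e := Filter.EventuallyEq.fderiv_eq h
  rw [← hLR, hL Y X, hBe] at hR
  simp only [ContinuousLinearMap.inr_apply, ContinuousLinearMap.prod_apply,
    zero_apply, hD1] at hR
  have hsymm := (hμ.isSymmSndFDerivAt (by simp)).eq (0, X) (Y, 0)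
  rw [VectorField.lieBracket, hL, hL, hD2, hD2, hR, hsymm]
  abel

end LocalMultiplication

/-! ### Derivatives as maps of the model spaces -/

section TangentDerivative

variable {E : Type*} [NormedAddCommGroup E] [NormedSpace ℝ E] {H : Type*} [TopologicalSpace H]
  {I : ModelWithCorners ℝ E H} {M : Type*} [TopologicalSpace M] [ChartedSpace H M]
  {E' : Type*} [NormedAddCommGroup E'] [NormedSpace ℝ E'] {H' : Type*} [TopologicalSpace H']
  {I' : ModelWithCorners ℝ E' H'} {N : Type*} [TopologicalSpace N] [ChartedSpace H' N]
  {E'' : Type*} [NormedAddCommGroup E''] [NormedSpace ℝ E''] {H'' : Type*} [TopologicalSpace H'']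
  {I'' : ModelWithCorners ℝ E'' H''} {K : Type*} [TopologicalSpace K] [ChartedSpace H'' K]

variable (I I') in
/-- The manifold derivative, as a map between the model vector spaces. -/
noncomputable def modelDeriv (f : M → N) (x : M) : E →L[ℝ] E' := mfderiv I I' f x

/-- The type of `modelDeriv` does not mention the base point, so the chain rule can be applied at a
point `y` only propositionally equal to `f x`, such as `1` for `g⁻¹ * g`. -/
lemma modelDeriv_comp {g : N → K} {f : M → N} {h : M → K} {x : M} {y : N} (hfx : f x = y)
    (hg : MDifferentiableAt I' I'' g y) (hf : MDifferentiableAt I I' f x)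
    (hh : h =ᶠ[𝓝 x] g ∘ f) (v : E) :
    modelDeriv I I'' h x v = modelDeriv I' I'' g y (modelDeriv I I' f x v) := by
  subst hfx
  have h1 : mfderiv I I'' h x = mfderiv I I'' (g ∘ f) x := hh.mfderiv_eq
  have h2 := mfderiv_comp x hg hf
  exact congrArg (fun L : E →L[ℝ] E'' => L v) (h1.trans h2)

lemma modelDeriv_congr {f g : M → N} {x : M} (h : f =ᶠ[𝓝 x] g) :
    modelDeriv I I' f x = modelDeriv I I' g x := h.mfderiv_eq

lemma modelDeriv_id (x : M) (v : E) : modelDeriv I I id x v = v :=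
  congrArg (fun L : E →L[ℝ] E => L v) (mfderiv_id (I := I) (x := x))

lemma modelDeriv_const (x : M) (y : N) (v : E) : modelDeriv I I' (fun _ => y) x v = 0 :=
  congrArg (fun L : E →L[ℝ] E' => L v) (mfderiv_const (I := I) (I' := I') (x := x) (c := y))

lemma modelDeriv_leftInverse {f : M → N} {g : N → M} {x : M} {y : N} (hfx : f x = y)
    (hg : MDifferentiableAt I' I g y) (hf : MDifferentiableAt I I' f x)
    (hgf : ∀ᶠ z in 𝓝 x, g (f z) = z) (v : E) :
    modelDeriv I' I g y (modelDeriv I I' f x v) = v := by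
  rw [← modelDeriv_comp (h := id) hfx hg hf (hgf.mono fun z hz => hz.symm), modelDeriv_id]

end TangentDerivative

/-! ### The adjoint representation and its derivative -/

section Adjoint

variable {n : ℕ} {G : Type*} [Group G] [TopologicalSpace G]
  [ChartedSpace (EuclideanSpace ℝ (Fin n)) G] [LieGroup (𝓡 n) ∞ G]

lemma mdifferentiableAt_mul_left (a b : G) :
    MDifferentiableAt (𝓡 n) (𝓡 n) (fun x : G => a * x) b :=
  (contMDiff_mul_left (I := 𝓡 n) (n := ∞) (a := a)).mdifferentiableAt (by simp)

lemma mdifferentiableAt_mul_right (a b : G) :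
    MDifferentiableAt (𝓡 n) (𝓡 n) (fun x : G => x * a) b :=
  (contMDiff_mul_right (I := 𝓡 n) (n := ∞) (a := a)).mdifferentiableAt (by simp)

lemma mdifferentiableAt_conj (a b : G) :
    MDifferentiableAt (𝓡 n) (𝓡 n) (fun x : G => a * x * a⁻¹) b :=
  MDifferentiableAt.comp (I' := 𝓡 n) b (mdifferentiableAt_mul_right a⁻¹ _)
    (mdifferentiableAt_mul_left a b)

lemma Ad_eq (g : G) (X : EuclideanSpace ℝ (Fin n)) :
    Ad (n := n) g X = modelDeriv (𝓡 n) (𝓡 n) (fun x : G => g * x * g⁻¹) 1 X := rfl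

lemma maurerCartan_eq (g : G) (X : EuclideanSpace ℝ (Fin n)) :
    maurerCartan (n := n) g X = modelDeriv (𝓡 n) (𝓡 n) (fun x : G => g⁻¹ * x) g X := rfl

lemma Ad_mul (g h : G) (X : EuclideanSpace ℝ (Fin n)) :
    Ad (n := n) (g * h) X = Ad (n := n) g (Ad (n := n) h X) := by
  simp only [Ad_eq]
  refine modelDeriv_comp (by simp) (mdifferentiableAt_conj g 1) (mdifferentiableAt_conj h 1)
    (.of_forall fun x => ?_) X
  simp [mul_assoc]

lemma Ad_one (X : EuclideanSpace ℝ (Fin n)) : Ad (n := n) (1 : G) X = X := by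
  rw [Ad_eq, modelDeriv_congr (g := id) (.of_forall fun x => by simp), modelDeriv_id]

lemma Ad_inv_Ad (g : G) (X : EuclideanSpace ℝ (Fin n)) :
    Ad (n := n) g⁻¹ (Ad (n := n) g X) = X := by
  rw [← Ad_mul, inv_mul_cancel, Ad_one]

lemma Ad_Ad_inv (g : G) (X : EuclideanSpace ℝ (Fin n)) :
    Ad (n := n) g (Ad (n := n) g⁻¹ X) = X := by
  rw [← Ad_mul, mul_inv_cancel, Ad_one]

end Adjoint

section AdjointDerivative

variable {n : ℕ} {G : Type*} [Group G] [TopologicalSpace G]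
  [ChartedSpace (EuclideanSpace ℝ (Fin n)) G] [LieGroup (𝓡 n) ∞ G]

lemma maurerCartan_one (X : EuclideanSpace ℝ (Fin n)) : maurerCartan (n := n) (1 : G) X = X := by
  rw [maurerCartan_eq, modelDeriv_congr (g := id) (.of_forall fun x => by simp), modelDeriv_id]

/-- By equivariance of the Maurer-Cartan form, `Ad g Y` is its value on the right translate of `Y`
by `g⁻¹`. That translate is the tangent map of multiplication at `(Y, 0)`, hence smooth in `g`. -/
lemma contMDiff_Ad (Y : EuclideanSpace ℝ (Fin n)) :
    ContMDiff (M' := EuclideanSpace ℝ (Fin n)) (𝓡 n) (𝓡 n) ∞ (fun g : G => Ad (n := n) g Y) := by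
  let F₁ : G → TangentBundle (𝓡 n) G × TangentBundle (𝓡 n) G :=
    fun g => (Bundle.TotalSpace.mk' _ 1 Y, Bundle.TotalSpace.mk' _ g⁻¹ 0)
  have S₁ : ContMDiff (𝓡 n) ((𝓡 n).tangent.prod (𝓡 n).tangent) ∞ F₁ := by
    refine ContMDiff.prodMk contMDiff_const ?_
    exact (Bundle.contMDiff_zeroSection ℝ (TangentSpace (𝓡 n) : G → Type _)).comp
      (contMDiff_inv (𝓡 n) ∞)
  let F₂ : (TangentBundle (𝓡 n) G × TangentBundle (𝓡 n) G) →
      TangentBundle ((𝓡 n).prod (𝓡 n)) (G × G) := (equivTangentBundleProd (𝓡 n) G (𝓡 n) G).symm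
  have S₂ : ContMDiff ((𝓡 n).tangent.prod (𝓡 n).tangent) ((𝓡 n).prod (𝓡 n)).tangent ∞ F₂ :=
    contMDiff_equivTangentBundleProd_symm
  let F₃ : TangentBundle ((𝓡 n).prod (𝓡 n)) (G × G) → TangentBundle (𝓡 n) G :=
    tangentMap ((𝓡 n).prod (𝓡 n)) (𝓡 n) (fun a : G × G => a.1 * a.2)
  have S₃ : ContMDiff ((𝓡 n).prod (𝓡 n)).tangent (𝓡 n).tangent ∞ F₃ :=
    ContMDiff.contMDiff_tangentMap (n := ∞) (contMDiff_mul (𝓡 n) ∞) le_rfl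
  have S := contMDiff_maurerCartan.comp ((S₃.comp S₂).comp S₁)
  have hS : ∀ g : G, (F₃ ∘ F₂) (F₁ g) =
      (⟨1 * g⁻¹, modelDeriv (𝓡 n) (𝓡 n) (fun v : G => v * g⁻¹) 1 Y⟩ : TangentBundle (𝓡 n) G) := by
    intro g
    simp only [Function.comp_apply, tangentMap, F₃, F₂, F₁]
    rw [mfderiv_prod_eq_add_apply ((contMDiff_mul (𝓡 n) ∞).mdifferentiableAt (by simp))]
    simp +instances [modelDeriv]
    refine congrArg (Bundle.TotalSpace.mk' (EuclideanSpace ℝ (Fin n)) (1 * g⁻¹)) ?_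
    have h0 : ∀ (L : EuclideanSpace ℝ (Fin n) →L[ℝ] EuclideanSpace ℝ (Fin n))
        (w : EuclideanSpace ℝ (Fin n)), w + L 0 = w := fun L w => by rw [map_zero, add_zero]
    exact h0 _ _
  refine S.congr fun g => ?_
  have h1 : (((F₃ ∘ F₂) ∘ F₁) g) = _ := hS g
  have h2 := maurerCartan_equivariant (n := n) g⁻¹ (1 : G) Y
  rw [inv_inv, maurerCartan_one] at h2
  exact h2.symm.trans (congrArg (fun v : TangentBundle (𝓡 n) G =>
    (maurerCartan v.proj v.2 : EuclideanSpace ℝ (Fin n))) h1).symm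

lemma mdifferentiableAt_Ad (Y : EuclideanSpace ℝ (Fin n)) (g : G) :
    MDifferentiableAt (M' := EuclideanSpace ℝ (Fin n)) (𝓡 n) (𝓡 n)
      (fun g : G => Ad (n := n) g Y) g :=
  (contMDiff_Ad Y).mdifferentiableAt (by simp)

/-- Differentiates `(x y x⁻¹) x = x y`. Read in a chart, this is the identity required by
`fderiv_adjoint_eq_lieBracket`. -/
lemma modelDeriv_mul_right_Ad (x : G) (Y : EuclideanSpace ℝ (Fin n)) :
    modelDeriv (𝓡 n) (𝓡 n) (fun y : G => y * x) 1 (Ad (n := n) x Y) =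
      modelDeriv (𝓡 n) (𝓡 n) (fun y : G => x * y) 1 Y := by
  rw [Ad_eq]
  refine (modelDeriv_comp (by simp) (mdifferentiableAt_mul_right x 1) (mdifferentiableAt_conj x 1)
    (.of_forall fun y => ?_) Y).symm
  simp

/-- The bracket of `GroupLieAlgebra` is defined through left invariant vector fields pulled back
along the chart at `1`. Here that pullback becomes explicit, as the differential of the chart. -/
lemma bracket_eq_lieBracket {φ : G → EuclideanSpace ℝ (Fin n)} {ψ : EuclideanSpace ℝ (Fin n) → G}
    (hφ : φ = extChartAt (𝓡 n) (1 : G)) (hψ : ψ = (extChartAt (𝓡 n) (1 : G)).symm)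
    (X Y : GroupLieAlgebra (𝓡 n) G) :
    modelDeriv (𝓡 n) (𝓡 n) φ 1 (⁅X, Y⁆ : GroupLieAlgebra (𝓡 n) G) =
    VectorField.lieBracket ℝ
      (fun a => modelDeriv (𝓡 n) (𝓡 n) φ (ψ a)
        (modelDeriv (𝓡 n) (𝓡 n) (fun y : G => ψ a * y) 1 X))
      (fun a => modelDeriv (𝓡 n) (𝓡 n) φ (ψ a)
        (modelDeriv (𝓡 n) (𝓡 n) (fun y : G => ψ a * y) 1 Y)) (φ 1) := by
  have hinv : ∀ a ∈ (extChartAt (𝓡 n) (1 : G)).target, ∀ Z : GroupLieAlgebra (𝓡 n) G,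
      VectorField.mpullbackWithin 𝓘(ℝ, EuclideanSpace ℝ (Fin n)) (𝓡 n)
        (extChartAt (𝓡 n) (1 : G)).symm
        (mulInvariantVectorField (I := 𝓡 n) (G := G) Z) (Set.range (𝓡 n)) a =
      modelDeriv (𝓡 n) (𝓡 n) φ (ψ a) (modelDeriv (𝓡 n) (𝓡 n) (fun y : G => ψ a * y) 1 Z) := by
    intro a ha Z
    rw [VectorField.mpullbackWithin_apply]
    have h1 := ContinuousLinearMap.inverse_eq
      (mfderivWithin_extChartAt_symm_comp_mfderiv_extChartAt (I := 𝓡 n) ha)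
      (mfderiv_extChartAt_comp_mfderivWithin_extChartAt_symm (I := 𝓡 n) ha)
    rw [h1, hφ, hψ]
    rfl
  have hev : ∀ Z : GroupLieAlgebra (𝓡 n) G,
      VectorField.mpullbackWithin 𝓘(ℝ, EuclideanSpace ℝ (Fin n)) (𝓡 n)
        (extChartAt (𝓡 n) (1 : G)).symm
        (mulInvariantVectorField (I := 𝓡 n) (G := G) Z) (Set.range (𝓡 n)) =ᶠ[𝓝 (φ 1)]
      fun a => modelDeriv (𝓡 n) (𝓡 n) φ (ψ a)
        (modelDeriv (𝓡 n) (𝓡 n) (fun y : G => ψ a * y) 1 Z) := by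
    intro Z
    rw [hφ]
    filter_upwards [extChartAt_target_mem_nhds (I := 𝓡 n) (1 : G)] with a ha
    exact hφ ▸ hinv a ha Z
  let V (Z : GroupLieAlgebra (𝓡 n) G) : EuclideanSpace ℝ (Fin n) → EuclideanSpace ℝ (Fin n) :=
    VectorField.mpullbackWithin 𝓘(ℝ, EuclideanSpace ℝ (Fin n)) (𝓡 n)
      (extChartAt (𝓡 n) (1 : G)).symm (mulInvariantVectorField (I := 𝓡 n) (G := G) Z)
      (Set.range (𝓡 n))
  let J := modelDeriv (𝓡 n) (𝓡 n) (extChartAt (𝓡 n) (1 : G)) 1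
  have hb : (⁅X, Y⁆ : GroupLieAlgebra (𝓡 n) G) = J.inverse (VectorField.lieBracketWithin ℝ (V X) (V Y)
        ((extChartAt (𝓡 n) (1 : G)).symm ⁻¹' Set.univ ∩ Set.range (𝓡 n))
        (extChartAt (𝓡 n) (1 : G) 1)) := rfl
  have hu : ((extChartAt (𝓡 n) (1 : G)).symm ⁻¹' Set.univ ∩ Set.range (𝓡 n)) = Set.univ := by
    simp
  rw [hu, VectorField.lieBracketWithin_univ] at hb
  have h2 : J.IsInvertible :=
    isInvertible_mfderiv_extChartAt (I := 𝓡 n) (mem_extChartAt_source (I := 𝓡 n) (1 : G))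
  have h3 : VectorField.lieBracket ℝ (V X) (V Y) (φ 1) = _ :=
    Filter.EventuallyEq.lieBracket_vectorField_eq (𝕜 := ℝ) (hev X) (hev Y)
  rw [← h3, hb, hφ]
  exact h2.self_apply_inverse _

/-- The derivative of the adjoint action of the group is the adjoint action of its Lie algebra. -/
theorem modelDeriv_Ad_one (X Y : EuclideanSpace ℝ (Fin n)) :
    modelDeriv (M := G) (N := EuclideanSpace ℝ (Fin n)) (𝓡 n) (𝓡 n)
      (fun g => Ad (n := n) g Y) 1 X =
    Bracket.bracket (L := GroupLieAlgebra (𝓡 n) G) (M := GroupLieAlgebra (𝓡 n) G) X Y := by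
  let E := EuclideanSpace ℝ (Fin n)
  obtain ⟨φ, hφ⟩ : ∃ φ : G → E, φ = extChartAt (𝓡 n) (1 : G) := ⟨_, rfl⟩
  obtain ⟨ψ, hψ⟩ : ∃ ψ : E → G, ψ = (extChartAt (𝓡 n) (1 : G)).symm := ⟨_, rfl⟩
  let S : Set G := (extChartAt (𝓡 n) (1 : G)).source
  let T : Set E := (extChartAt (𝓡 n) (1 : G)).target
  have hS : IsOpen S := isOpen_extChartAt_source (1 : G)
  have hT : IsOpen T := isOpen_extChartAt_target (1 : G)
  have h1S : (1 : G) ∈ S := mem_extChartAt_source (1 : G)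
  have heT : φ 1 ∈ T := by rw [hφ]; exact mem_extChartAt_target (1 : G)
  have hψS : ∀ a ∈ T, ψ a ∈ S := fun a ha => by
    rw [hψ]; exact (extChartAt (𝓡 n) (1 : G)).map_target ha
  have hψφ : ∀ x ∈ S, ψ (φ x) = x := fun x hx => by
    rw [hψ, hφ]; exact (extChartAt (𝓡 n) (1 : G)).left_inv hx
  have hφψ : ∀ a ∈ T, φ (ψ a) = a := fun a ha => by
    rw [hψ, hφ]; exact (extChartAt (𝓡 n) (1 : G)).right_inv ha
  have hφs : ∀ x ∈ S, ContMDiffAt (𝓡 n) (𝓡 n) ∞ φ x := fun x hx => by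
    rw [hφ]
    exact contMDiffAt_extChartAt' (by simpa [S] using hx)
  have hψs : ∀ a ∈ T, ContMDiffAt (𝓡 n) (𝓡 n) ∞ ψ a := fun a ha => by
    rw [hψ]
    exact (contMDiffOn_extChartAt_symm (1 : G)).contMDiffAt (hT.mem_nhds ha)
  have hφd : ∀ x ∈ S, MDifferentiableAt (𝓡 n) (𝓡 n) φ x := fun x hx =>
    (hφs x hx).mdifferentiableAt (by simp)
  have hψd : ∀ a ∈ T, MDifferentiableAt (𝓡 n) (𝓡 n) ψ a := fun a ha =>
    (hψs a ha).mdifferentiableAt (by simp)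
  -- The group multiplication read in the chart at `1`. Its partial derivatives at the unit are the
  -- chart expressions of the left and right invariant fields (`hleft`, `hright`).
  let μ : E × E → E := fun z => φ (ψ z.1 * ψ z.2)
  have hμ : ∀ a ∈ T, ∀ b ∈ T, ψ a * ψ b ∈ S → ContDiffAt ℝ ∞ μ (a, b) := by
    intro a ha b hb hab
    have h1 : ContMDiffAt 𝓘(ℝ, E × E) (𝓡 n) ∞ (fun z : E × E => ψ z.1) (a, b) :=
      ContMDiffAt.comp (I' := 𝓡 n) (a, b) (hψs a ha) contDiff_fst.contMDiff.contMDiffAt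
    have h2 : ContMDiffAt 𝓘(ℝ, E × E) (𝓡 n) ∞ (fun z : E × E => ψ z.2) (a, b) :=
      ContMDiffAt.comp (I' := 𝓡 n) (a, b) (hψs b hb) contDiff_snd.contMDiff.contMDiffAt
    exact contMDiffAt_iff_contDiffAt.1 (ContMDiffAt.comp (I' := 𝓡 n) (a, b) (hφs _ hab) (h1.mul h2))
  have hψe : ψ (φ 1) = 1 := hψφ 1 h1S
  have hμl : ∀ a ∈ T, ContDiffAt ℝ ∞ μ (a, φ 1) := fun a ha =>
    hμ a ha _ heT (by rw [hψe, mul_one]; exact hψS a ha)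
  have hμr : ∀ a ∈ T, ContDiffAt ℝ ∞ μ (φ 1, a) := fun a ha =>
    hμ _ heT a ha (by rw [hψe, one_mul]; exact hψS a ha)
  have hleft : ∀ a ∈ T, ∀ Z : E, fderiv ℝ μ (a, φ 1) (0, modelDeriv (𝓡 n) (𝓡 n) φ 1 Z) =
      modelDeriv (𝓡 n) (𝓡 n) φ (ψ a) (modelDeriv (𝓡 n) (𝓡 n) (fun y : G => ψ a * y) 1 Z) := by
    intro a ha Z
    have h1 := HasFDerivAt.comp (φ 1) (f := fun b : E => (a, b)) (g := μ)
      ((hμl a ha).differentiableAt (by simp)).hasFDerivAt (hasFDerivAt_prodMk_right a (φ 1))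
    have h2 : modelDeriv (𝓡 n) (𝓡 n) (μ ∘ fun b : E => (a, b)) (φ 1)
        (modelDeriv (𝓡 n) (𝓡 n) φ 1 Z) =
        fderiv ℝ μ (a, φ 1) (0, modelDeriv (𝓡 n) (𝓡 n) φ 1 Z) := by
      rw [modelDeriv, mfderiv_eq_fderiv, h1.fderiv]
      rfl
    have hm : MDifferentiableAt (𝓡 n) (𝓡 n) (μ ∘ fun b : E => (a, b)) (φ 1) :=
      h1.differentiableAt.mdifferentiableAt
    have hx : (fun y : G => ψ a * y) 1 = ψ a := mul_one _
    rw [← h2, ← modelDeriv_comp (h := (μ ∘ fun b : E => (a, b)) ∘ φ) rfl hm (hφd 1 h1S)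
      (.of_forall fun _ => rfl)]
    refine modelDeriv_comp hx (hφd _ (hψS a ha)) (mdifferentiableAt_mul_left (ψ a) 1) ?_ Z
    filter_upwards [hS.mem_nhds h1S] with x hx
    simp [μ, hψφ x hx]
  have hright : ∀ a ∈ T, ∀ Z : E, fderiv ℝ μ (φ 1, a) (modelDeriv (𝓡 n) (𝓡 n) φ 1 Z, 0) =
      modelDeriv (𝓡 n) (𝓡 n) φ (ψ a) (modelDeriv (𝓡 n) (𝓡 n) (fun y : G => y * ψ a) 1 Z) := by
    intro a ha Z
    have h1 := HasFDerivAt.comp (φ 1) (f := fun b : E => (b, a)) (g := μ)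
      ((hμr a ha).differentiableAt (by simp)).hasFDerivAt (hasFDerivAt_prodMk_left (φ 1) a)
    have h2 : modelDeriv (𝓡 n) (𝓡 n) (μ ∘ fun b : E => (b, a)) (φ 1)
        (modelDeriv (𝓡 n) (𝓡 n) φ 1 Z) =
        fderiv ℝ μ (φ 1, a) (modelDeriv (𝓡 n) (𝓡 n) φ 1 Z, 0) := by
      rw [modelDeriv, mfderiv_eq_fderiv, h1.fderiv]
      rfl
    have hm : MDifferentiableAt (𝓡 n) (𝓡 n) (μ ∘ fun b : E => (b, a)) (φ 1) :=
      h1.differentiableAt.mdifferentiableAt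
    have hx : (fun y : G => y * ψ a) 1 = ψ a := one_mul _
    rw [← h2, ← modelDeriv_comp (h := (μ ∘ fun b : E => (b, a)) ∘ φ) rfl hm (hφd 1 h1S)
      (.of_forall fun _ => rfl)]
    refine modelDeriv_comp (f := fun y : G => y * ψ a) hx (hφd _ (hψS a ha))
      (mdifferentiableAt_mul_right (ψ a) 1) ?_ Z
    filter_upwards [hS.mem_nhds h1S] with x hx
    simp [μ, hψφ x hx]
  let L : E →L[ℝ] E := modelDeriv (𝓡 n) (𝓡 n) φ 1
  let F : G → E := fun g => Ad (n := n) g Y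
  have hF : MDifferentiableAt (𝓡 n) (𝓡 n) F 1 := mdifferentiableAt_Ad Y 1
  let A : G → E := L ∘ F
  have hL : MDifferentiableAt (𝓡 n) (𝓡 n) L (F 1) := L.differentiableAt.mdifferentiableAt
  have hA : MDifferentiableAt (𝓡 n) (𝓡 n) A 1 := MDifferentiableAt.comp (I' := 𝓡 n) (1 : G) hL hF
  have hLd : modelDeriv (𝓡 n) (𝓡 n) L (F 1) = L := mfderiv_eq_fderiv.trans L.fderiv
  have hAX : modelDeriv (𝓡 n) (𝓡 n) A 1 X = L (modelDeriv (𝓡 n) (𝓡 n) F 1 X) := by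
    rw [modelDeriv_comp (h := A) rfl hL hF (.of_forall fun _ => rfl), hLd]
  have hB : DifferentiableAt ℝ (A ∘ ψ) (φ 1) := by
    rw [← mdifferentiableAt_iff_differentiableAt]
    refine MDifferentiableAt.comp (I' := 𝓡 n) (φ 1) ?_ (hψd _ heT)
    rw [hψe]
    exact hA
  have hBX : fderiv ℝ (A ∘ ψ) (φ 1) (modelDeriv (𝓡 n) (𝓡 n) φ 1 X) =
      modelDeriv (𝓡 n) (𝓡 n) A 1 X := by
    have h1 : modelDeriv (𝓡 n) (𝓡 n) (A ∘ ψ) (φ 1) = fderiv ℝ (A ∘ ψ) (φ 1) := mfderiv_eq_fderiv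
    rw [← h1]
    refine (modelDeriv_comp rfl (mdifferentiableAt_iff_differentiableAt.2 hB) (hφd 1 h1S) ?_ X).symm
    filter_upwards [hS.mem_nhds h1S] with x hx
    simp [hψφ x hx]
  have hkey := fderiv_adjoint_eq_lieBracket (μ := μ) (e := φ 1)
    ((hμl _ heT).of_le (by norm_cast))
    (by filter_upwards [hT.mem_nhds heT] with a ha; simp only [μ, hψe, one_mul, hφψ a ha])
    (by filter_upwards [hT.mem_nhds heT] with a ha; simp [μ, hψe, hφψ a ha])
    hB (modelDeriv (𝓡 n) (𝓡 n) φ 1 X) (modelDeriv (𝓡 n) (𝓡 n) φ 1 Y)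
    (by simp only [Function.comp_apply, A, hψe]; exact congrArg L (Ad_one Y))
    (by
      filter_upwards [hT.mem_nhds heT] with a ha
      rw [hleft a ha]
      exact ((hright a ha _).trans (congrArg _ (modelDeriv_mul_right_Ad (ψ a) Y))).symm)
  rw [hBX, hAX] at hkey
  have hlie := bracket_eq_lieBracket hφ hψ X Y
  have hcongr : ∀ Z : E, (fun a => fderiv ℝ μ (a, φ 1) (0, modelDeriv (𝓡 n) (𝓡 n) φ 1 Z))
      =ᶠ[𝓝 (φ 1)] fun a => modelDeriv (𝓡 n) (𝓡 n) φ (ψ a)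
        (modelDeriv (𝓡 n) (𝓡 n) (fun y : G => ψ a * y) 1 Z) := fun Z => by
    filter_upwards [hT.mem_nhds heT] with a ha using hleft a ha Z
  rw [Filter.EventuallyEq.lieBracket_vectorField_eq (𝕜 := ℝ) (hcongr X) (hcongr Y), ← hlie] at hkey
  have hinj : Function.Injective (modelDeriv (𝓡 n) (𝓡 n) φ 1 : E →L[ℝ] E) := by
    refine Function.LeftInverse.injective (g := modelDeriv (𝓡 n) (𝓡 n) ψ (φ 1)) fun Z => ?_
    refine modelDeriv_leftInverse rfl (hψd _ heT) (hφd 1 h1S) ?_ Z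
    filter_upwards [hS.mem_nhds h1S] with x hx using hψφ x hx
  exact hinj hkey

/-- `Ad g` is a homomorphism of Lie algebras. -/
theorem Ad_lie (g : G) (X Y : GroupLieAlgebra (𝓡 n) G) : Ad g ⁅X, Y⁆ = ⁅Ad g X, Ad g Y⁆ := by
  let E := EuclideanSpace ℝ (Fin n)
  let L : E →L[ℝ] E := Ad (n := n) g
  let F : G → E := fun g => Ad (n := n) g Y
  let F' : G → E := fun x => Ad (n := n) x (Ad (n := n) g Y)
  -- Both `h1` and `h3` compute the derivative at `x = 1` along `X` of `Ad g (Ad x Y) = Ad (g x g⁻¹)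
  -- (Ad g Y)`.
  have h1 : modelDeriv (𝓡 n) (𝓡 n) (L ∘ F) 1 X = Ad g (⁅X, Y⁆ : GroupLieAlgebra (𝓡 n) G) := by
    have hL : modelDeriv (𝓡 n) (𝓡 n) L (F 1) = L := mfderiv_eq_fderiv.trans L.fderiv
    have h2 := modelDeriv_comp (I := 𝓡 n) (I' := 𝓡 n) (I'' := 𝓡 n) (g := L) (f := F) (h := L ∘ F)
      rfl L.differentiableAt.mdifferentiableAt (mdifferentiableAt_Ad Y 1) (.of_forall fun _ => rfl) X
    exact (h2.trans (congrArg (fun M : E →L[ℝ] E => M _) hL)).trans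
      (congrArg L (modelDeriv_Ad_one X Y))
  have h3 : modelDeriv (𝓡 n) (𝓡 n) (L ∘ F) 1 X =
      (⁅Ad g X, Ad g Y⁆ : GroupLieAlgebra (𝓡 n) G) := by
    refine Eq.trans ?_ (modelDeriv_Ad_one (Ad (n := n) g X) (Ad (n := n) g Y))
    refine modelDeriv_comp (by simp) (mdifferentiableAt_Ad _ 1) (mdifferentiableAt_conj g 1)
      (.of_forall fun x => ?_) X
    have h4 := Ad_mul (n := n) g x Y
    have h5 := Ad_mul (n := n) (g * x * g⁻¹) g (Y : E)
    simp only [inv_mul_cancel_right] at h5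
    exact h4.symm.trans h5
  exact h1.symm.trans h3

end AdjointDerivative

/-- Trades the projection to `𝔤₋₁` for a congruence modulo `𝔭`, which is what the differential of
the bundle projection detects. -/
lemma actsAsNegId_iff {n : ℕ} {G : Type*} [Group G] [TopologicalSpace G]
    [ChartedSpace (EuclideanSpace ℝ (Fin n)) G] [LieGroup (𝓡 n) ∞ G]
    (D : OneGrading (GroupLieAlgebra (𝓡 n) G)) (g : G) :
    ActsAsNegId D g ↔ ∀ X ∈ D.gr (-1), Ad g X + X ∈ D.filt 0 := by
  refine forall₂_congr fun X hX => ?_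
  rw [D.mem_filt_zero_iff, D.proj_add, D.proj_of_mem hX, ← eq_neg_iff_add_eq_zero]
  rfl

/-! ### Vertical vectors and symmetries of a general Cartan geometry -/

namespace CartanGeometry

variable {n p b m : ℕ} {G : Type*} [Group G] [TopologicalSpace G]
  [ChartedSpace (EuclideanSpace ℝ (Fin n)) G] [LieGroup (𝓡 n) ∞ G]
  {P : Subgroup G} [ChartedSpace (EuclideanSpace ℝ (Fin p)) P] [LieGroup (𝓡 p) ∞ P]
  {B : Type*} [TopologicalSpace B] [ChartedSpace (EuclideanSpace ℝ (Fin b)) B]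
  [IsManifold (𝓡 b) ∞ B]
  {M : Type*} [TopologicalSpace M] [ChartedSpace (EuclideanSpace ℝ (Fin m)) M]
  [IsManifold (𝓡 m) ∞ M]
  (C : CartanGeometry n p b m P B M)

lemma omega_congr {u v : B} (h : u = v) (ξ : EuclideanSpace ℝ (Fin b)) :
    (C.omega u ξ : EuclideanSpace ℝ (Fin n)) = C.omega v ξ := by
  subst h; rfl

lemma act_act_inv (u : B) (h : P) : C.act (C.act u h) h⁻¹ = u := by
  rw [← C.act_mul, mul_inv_cancel, C.act_one]

lemma contMDiff_act_left (h : P) : ContMDiff (𝓡 b) (𝓡 b) ∞ (fun u => C.act u h) :=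
  C.contMDiff_act.comp (contMDiff_id.prodMk contMDiff_const)

lemma contMDiff_act_right (u : B) : ContMDiff (𝓡 p) (𝓡 b) ∞ (fun h => C.act u h) :=
  C.contMDiff_act.comp (contMDiff_const.prodMk contMDiff_id)

lemma contMDiff_proj : ContMDiff (𝓡 b) (𝓡 m) ∞ C.proj := by
  intro u
  obtain ⟨e, hx, he, -, -⟩ := C.locallyTrivial (C.proj u)
  have hu : u ∈ e.source := e.mem_source.2 hx
  have h1 := contMDiffAt_fst.comp u (he.contMDiffAt (e.open_source.mem_nhds hu))
  refine h1.congr_of_eventuallyEq ?_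
  filter_upwards [e.open_source.mem_nhds hu] with v hv using (e.coe_fst hv).symm

lemma exists_proj_eq (x : M) : ∃ u, C.proj u = x := by
  obtain ⟨e, hx, -, -, -⟩ := C.locallyTrivial x
  exact ⟨e.toOpenPartialHomeomorph.symm (x, 1), e.proj_symm_apply' hx⟩

lemma exists_act_eq {u v : B} (h : C.proj u = C.proj v) : ∃ k : P, v = C.act u k := by
  obtain ⟨e, hx, -, -, he⟩ := C.locallyTrivial (C.proj u)
  have hu : u ∈ e.source := e.mem_source.2 hx
  have hv : v ∈ e.source := e.mem_source.2 (h ▸ hx)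
  refine ⟨(e u).2⁻¹ * (e v).2, e.injOn hv (e.mem_source.2 ((C.proj_act u _).symm ▸ hx)) ?_⟩
  change e v = e (C.act u _)
  rw [he u hu, mul_inv_cancel_left, e.coe_fst hu, h, ← e.coe_fst hv]

/-- The kernel of the differential of the bundle projection is the vertical space. -/
lemma exists_of_modelDeriv_proj_eq_zero (u : B) (ξ : EuclideanSpace ℝ (Fin b))
    (hξ : modelDeriv (𝓡 b) (𝓡 m) C.proj u ξ = 0) :
    ∃ X : EuclideanSpace ℝ (Fin p), modelDeriv (𝓡 p) (𝓡 b) (fun h => C.act u h) 1 X = ξ := by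
  obtain ⟨e, hx, he, hes, hact⟩ := C.locallyTrivial (C.proj u)
  have hu : u ∈ e.source := e.mem_source.2 hx
  have heu : e u ∈ e.target := e.map_source hu
  have hed : MDifferentiableAt (𝓡 b) ((𝓡 m).prod (𝓡 p)) e u :=
    (he.contMDiffAt (e.open_source.mem_nhds hu)).mdifferentiableAt (by simp)
  have hesd : MDifferentiableAt ((𝓡 m).prod (𝓡 p)) (𝓡 b) e.toOpenPartialHomeomorph.symm (e u) :=
    (hes.contMDiffAt (e.open_target.mem_nhds heu)).mdifferentiableAt (by simp)
  let ζ := modelDeriv (𝓡 b) ((𝓡 m).prod (𝓡 p)) e u ξ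
  have hζ1 : ζ.1 = 0 := by
    rw [← hξ, modelDeriv_comp (I' := (𝓡 m).prod (𝓡 p)) (g := Prod.fst) (f := e) rfl
      mdifferentiableAt_fst hed
      (by filter_upwards [e.open_source.mem_nhds hu] with v hv using (e.coe_fst hv).symm)]
    exact (congrArg (fun L : EuclideanSpace ℝ (Fin m) × EuclideanSpace ℝ (Fin p) →L[ℝ] _ => L ζ)
      (mfderiv_fst (I := 𝓡 m) (I' := 𝓡 p) (x := e u))).symm
  have hback : modelDeriv ((𝓡 m).prod (𝓡 p)) (𝓡 b) e.toOpenPartialHomeomorph.symm (e u) ζ = ξ := by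
    refine modelDeriv_leftInverse rfl hesd hed ?_ ξ
    filter_upwards [e.open_source.mem_nhds hu] with v hv
    exact e.toOpenPartialHomeomorph.left_inv hv
  let ι : P → M × P := fun k => ((e u).1, k)
  have hι : MDifferentiableAt (𝓡 p) ((𝓡 m).prod (𝓡 p)) ι (e u).2 :=
    mdifferentiableAt_const.prodMk mdifferentiableAt_id
  have hιd : modelDeriv (𝓡 p) ((𝓡 m).prod (𝓡 p)) ι (e u).2 ζ.2 = ζ := by
    have h1 : modelDeriv (𝓡 p) ((𝓡 m).prod (𝓡 p)) ι (e u).2 ζ.2 = (0, ζ.2) :=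
      congrArg (fun L : EuclideanSpace ℝ (Fin p) →L[ℝ] _ => L ζ.2)
        (mfderiv_prod_right (I := 𝓡 m) (I' := 𝓡 p) (x₀ := (e u).1) (y₀ := (e u).2))
    rw [h1, ← hζ1]
  -- By equivariance the inverse trivialization along the fiber is the orbit map of `u` after this
  -- translation, which moves the base point `(e u).2` to `1`.
  let τ : P → P := fun k => (e u).2⁻¹ * k
  have hτ : MDifferentiableAt (𝓡 p) (𝓡 p) τ (e u).2 :=
    (contMDiff_mul_left (I := 𝓡 p) (n := ∞) (a := (e u).2⁻¹)).mdifferentiableAt (by simp)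
  have hsymm : ∀ k : P, C.act u (τ k) = e.toOpenPartialHomeomorph.symm (ι k) := by
    intro k
    have h1 : C.act u (τ k) ∈ e.source := e.mem_source.2 ((C.proj_act u _).symm ▸ hx)
    rw [← e.toOpenPartialHomeomorph.left_inv h1]
    refine congrArg _ ((hact u hu _).trans ?_)
    simp [τ, ι]
  refine ⟨modelDeriv (𝓡 p) (𝓡 p) τ (e u).2 ζ.2, ?_⟩
  rw [← modelDeriv_comp (h := fun k => C.act u (τ k)) (by simp [τ])
    ((C.contMDiff_act_right u).mdifferentiableAt (by simp)) hτ (.of_forall fun _ => rfl)]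
  have h1 := modelDeriv_comp (I := 𝓡 p) (I' := (𝓡 m).prod (𝓡 p)) (I'' := 𝓡 b) (f := ι)
    (h := fun k => C.act u (τ k)) (x := (e u).2) rfl hesd hι (.of_forall hsymm) ζ.2
  rw [hιd] at h1
  exact h1.trans hback

lemma modelDeriv_proj_act (u : B) (X : EuclideanSpace ℝ (Fin p)) :
    modelDeriv (𝓡 b) (𝓡 m) C.proj u (modelDeriv (𝓡 p) (𝓡 b) (fun h => C.act u h) 1 X) = 0 := by
  rw [← modelDeriv_comp (h := fun _ => C.proj u) (C.act_one u)
    (C.contMDiff_proj.mdifferentiableAt (by simp))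
    ((C.contMDiff_act_right u).mdifferentiableAt (by simp))
    (.of_forall fun h => (C.proj_act u h).symm), modelDeriv_const]

variable {D : OneGrading (GroupLieAlgebra (𝓡 n) G)}

/-- Vertical tangent vectors are those on which the Cartan connection takes values in `𝔭`. -/
theorem modelDeriv_proj_eq_zero_iff (hP : IsParabolicSubgroup p D P) (u : B)
    (ξ : EuclideanSpace ℝ (Fin b)) :
    modelDeriv (𝓡 b) (𝓡 m) C.proj u ξ = 0 ↔ C.omega u ξ ∈ D.filt 0 := by
  have hω : ∀ X : EuclideanSpace ℝ (Fin p),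
      C.omega u (modelDeriv (𝓡 p) (𝓡 b) (fun h => C.act u h) 1 X) =
        mfderiv (𝓡 p) (𝓡 n) (Subtype.val : P → G) 1 X := fun X =>
    (C.omega_congr (C.act_one u) _).symm.trans (C.omega_fundamental u X)
  rw [← SetLike.mem_coe, ← hP.range_eq]
  constructor
  · intro h
    obtain ⟨X, rfl⟩ := C.exists_of_modelDeriv_proj_eq_zero u ξ h
    exact ⟨X, (hω X).symm⟩
  · rintro ⟨X, hX⟩
    -- `ξ` and the fundamental vector of `X` have the same value under the injective `ω u`, so they
    -- coincide.
    rw [← (C.bijective_omega u).1 ((hω X).trans hX)]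
    exact C.modelDeriv_proj_act u X

/-- If an automorphism covers a map with differential `-id` at a fixed point, then it acts on the
fiber over that point by elements acting as `-id` on `𝔤₋₁`. -/
theorem actsAsNegId_of_covers (hP : IsParabolicSubgroup p D P) {s : M → M} {φ : B → B} {u : B}
    {h : P} (hs : MDifferentiableAt (𝓡 m) (𝓡 m) s (C.proj u))
    (hs' : ∀ v, modelDeriv (𝓡 m) (𝓡 m) s (C.proj u) v = -v)
    (hφ : MDifferentiableAt (𝓡 b) (𝓡 b) φ u)
    (hcov : ∀ᶠ v in 𝓝 u, C.proj (φ v) = s (C.proj v))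
    (hω : ∀ ξ, (C.omega (φ u) (modelDeriv (𝓡 b) (𝓡 b) φ u ξ) : EuclideanSpace ℝ (Fin n)) =
      C.omega u ξ) (hu : φ u = C.act u h) : ActsAsNegId D (h : G) := by
  rw [actsAsNegId_iff]
  intro X _
  obtain ⟨ξ, rfl⟩ : ∃ ξ : EuclideanSpace ℝ (Fin b), C.omega u ξ = X := (C.bijective_omega u).2 X
  have hp : ∀ v, MDifferentiableAt (𝓡 b) (𝓡 m) C.proj v := fun v =>
    C.contMDiff_proj.mdifferentiableAt (by simp)
  -- `R` brings `φ u` back to `u` without changing projections. Thus `η` lies in the tangent space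
  -- at `u`, has `ω`-value `Ad h (ω ξ)`, and projects to minus the projection of `ξ`.
  let R : B → B := fun v => C.act v h⁻¹
  have hR : MDifferentiableAt (𝓡 b) (𝓡 b) R (φ u) :=
    (C.contMDiff_act_left h⁻¹).mdifferentiableAt (by simp)
  have hRu : R (φ u) = u := by simp only [R, hu, C.act_act_inv]
  let ζ := modelDeriv (𝓡 b) (𝓡 b) φ u ξ
  let η := modelDeriv (𝓡 b) (𝓡 b) R (φ u) ζ
  have hη : C.omega u η = Ad (h : G) (C.omega u ξ) := by
    have h1 := C.omega_equivariant h⁻¹ (φ u) ζ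
    have h2 : (C.omega u η : EuclideanSpace ℝ (Fin n)) = _ := (C.omega_congr hRu η).symm.trans h1
    refine h2.trans ?_
    simp only [InvMemClass.coe_inv, inv_inv]
    exact congrArg (Ad (h : G)) (hω ξ)
  have h1 : modelDeriv (𝓡 b) (𝓡 m) C.proj u η = modelDeriv (𝓡 b) (𝓡 m) C.proj (φ u) ζ :=
    (modelDeriv_comp (h := C.proj) hRu (hp u) hR
      (.of_forall fun v => (C.proj_act v h⁻¹).symm) ζ).symm
  have h2 : modelDeriv (𝓡 b) (𝓡 m) C.proj (φ u) ζ = -modelDeriv (𝓡 b) (𝓡 m) C.proj u ξ := by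
    rw [← hs']
    refine (modelDeriv_comp (h := fun v => C.proj (φ v)) rfl (hp _) hφ
      (.of_forall fun _ => rfl) ξ).symm.trans ?_
    exact modelDeriv_comp (I' := 𝓡 m) (g := s) rfl hs (hp u) hcov ξ
  have h3 : C.omega u (η + ξ) ∈ D.filt 0 := by
    rw [← C.modelDeriv_proj_eq_zero_iff hP, map_add, h1, h2, neg_add_cancel]
  have h4 : C.omega u (η + ξ) = C.omega u η + C.omega u ξ := map_add (C.omega u) η ξ
  rwa [h4, hη] at h3

/-- The fiberwise form of `actsAsNegId_of_covers` for a symmetry. -/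
theorem IsSymmetryOn.exists_actsAsNegId {C : CartanGeometry n p b m P B M}
    (hP : IsParabolicSubgroup p D P) {x : M} {U : Set M}
    {s : PartialDiffeomorph (𝓡 m) (𝓡 m) M M ∞} (hs : C.IsSymmetryOn x U s)
    {φ : PartialDiffeomorph (𝓡 b) (𝓡 b) B B ∞} (hφ : C.IsLocalAutomorphism U φ)
    (hcov : ∀ u ∈ C.proj ⁻¹' U, C.proj (φ u) = s (C.proj u)) {u : B} (hu : C.proj u = x) :
    ∃ h : P, φ u = C.act u h ∧ ActsAsNegId D (h : G) := by
  have hmem : C.proj u ∈ U := hu ▸ hs.mem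
  obtain ⟨h, hh⟩ := C.exists_act_eq (u := u) (v := φ u)
    (by rw [hcov u hmem, hu, hs.map_center])
  refine ⟨h, hh, C.actsAsNegId_of_covers hP (s := s) ?_ ?_ ?_ ?_ (hφ.pullback_omega u hmem) hh⟩
  · exact s.mdifferentiableAt (by simp) (hs.subset_source hmem)
  · rw [hu]; exact hs.mfderiv_center
  · exact φ.mdifferentiableAt (by simp) (by rw [hφ.source_eq]; exact hmem)
  · filter_upwards [(hs.isOpen.preimage C.contMDiff_proj.continuous).mem_nhds hmem] with v hv
    exact hcov v hv

end CartanGeometry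

/-- In charts, a map with zero derivative on a ball is constant by convexity, and injectivity of the
target chart carries this back to `N`. -/
lemma eventually_eq_of_modelDeriv_eq_zero {k l : ℕ}
    {M : Type*} [TopologicalSpace M] [ChartedSpace (EuclideanSpace ℝ (Fin k)) M]
    [IsManifold (𝓡 k) ∞ M]
    {N : Type*} [TopologicalSpace N] [ChartedSpace (EuclideanSpace ℝ (Fin l)) N]
    [IsManifold (𝓡 l) ∞ N] {f : M → N} {x : M}
    (hf : ∀ᶠ z in 𝓝 x, MDifferentiableAt (𝓡 k) (𝓡 l) f z)
    (hf' : ∀ᶠ z in 𝓝 x, ∀ v, modelDeriv (𝓡 k) (𝓡 l) f z v = 0) : ∀ᶠ z in 𝓝 x, f z = f x := by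
  let χ := extChartAt (𝓡 l) (f x)
  let ψ := (extChartAt (𝓡 k) x).symm
  let e := extChartAt (𝓡 k) x x
  have hfc : ContinuousAt f x := hf.self_of_nhds.continuousAt
  have hsrc : ∀ᶠ z in 𝓝 x, f z ∈ χ.source :=
    hfc.eventually (extChartAt_source_mem_nhds (f x))
  have hψc : Filter.Tendsto ψ (𝓝 e) (𝓝 x) := by
    have := continuousAt_extChartAt_symm (I := 𝓡 k) x
    rwa [ContinuousAt, extChartAt_to_inv] at this
  obtain ⟨r, hr, hball⟩ := Metric.eventually_nhds_iff_ball.1 ((hψc.eventually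
    (hf.and (hf'.and hsrc))).and (extChartAt_target_mem_nhds (I := 𝓡 k) x))
  have hψd : ∀ a ∈ Metric.ball e r, MDifferentiableAt (𝓡 k) (𝓡 k) ψ a := fun a ha =>
    ((contMDiffOn_extChartAt_symm (n := ∞) x).contMDiffAt
      ((isOpen_extChartAt_target x).mem_nhds (hball a ha).2)).mdifferentiableAt (by simp)
  have hχd : ∀ a ∈ Metric.ball e r, MDifferentiableAt (𝓡 l) (𝓡 l) χ (f (ψ a)) := fun a ha =>
    (contMDiffAt_extChartAt' (n := ∞)
      (by simpa [χ] using (hball a ha).1.2.2)).mdifferentiableAt (by simp)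
  have hfψ : ∀ a ∈ Metric.ball e r, MDifferentiableAt (𝓡 k) (𝓡 l) (f ∘ ψ) a := fun a ha =>
    MDifferentiableAt.comp a (hball a ha).1.1 (hψd a ha)
  have hg : ∀ a ∈ Metric.ball e r, MDifferentiableAt (𝓡 k) (𝓡 l) (χ ∘ f ∘ ψ) a := fun a ha =>
    MDifferentiableAt.comp a (hχd a ha) (hfψ a ha)
  have hg' : ∀ a ∈ Metric.ball e r, fderiv ℝ (χ ∘ f ∘ ψ) a = 0 := by
    intro a ha
    ext1 v
    have h1 : modelDeriv (𝓡 k) (𝓡 l) (χ ∘ f ∘ ψ) a = fderiv ℝ (χ ∘ f ∘ ψ) a := mfderiv_eq_fderiv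
    rw [← h1, modelDeriv_comp (g := χ) (f := f ∘ ψ) rfl (hχd a ha) (hfψ a ha)
      (.of_forall fun _ => rfl), modelDeriv_comp (g := f) (f := ψ) rfl (hball a ha).1.1 (hψd a ha)
      (.of_forall fun _ => rfl), (hball a ha).1.2.1, map_zero]
    rfl
  have hconst : ∀ a ∈ Metric.ball e r, χ (f (ψ a)) = χ (f (ψ e)) := fun a ha =>
    Metric.isOpen_ball.is_const_of_fderiv_eq_zero (convex_ball e r).isPreconnected
      (fun z hz => (mdifferentiableAt_iff_differentiableAt.1 (hg z hz)).differentiableWithinAt)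
      (fun z hz => hg' z hz) ha (Metric.mem_ball_self hr)
  have hψe : ψ e = x := extChartAt_to_inv x
  filter_upwards [(continuousAt_extChartAt (I := 𝓡 k) x).eventually (Metric.ball_mem_nhds e hr),
    extChartAt_source_mem_nhds (I := 𝓡 k) x, hsrc] with z hz hzs hzf
  have h1 := hconst _ hz
  rw [hψe, (extChartAt (𝓡 k) x).left_inv hzs] at h1
  exact χ.injOn hzf (mem_extChartAt_source (f x)) h1

/-! ### Rigidity of the Maurer-Cartan form -/

section Rigidity

variable {n : ℕ} {G : Type*} [Group G] [TopologicalSpace G]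
  [ChartedSpace (EuclideanSpace ℝ (Fin n)) G] [LieGroup (𝓡 n) ∞ G]

/-- The right side involves only the value and derivative of `φ` at `u`, so `φ` may be replaced by
any map with the same first-order data there. -/
lemma modelDeriv_mul_inv {φ : G → G} {u : G} (hφ : MDifferentiableAt (𝓡 n) (𝓡 n) φ u)
    (ξ : EuclideanSpace ℝ (Fin n)) :
    modelDeriv (𝓡 n) (𝓡 n) (fun v => φ v * v⁻¹) u ξ =
      modelDeriv ((𝓡 n).prod (𝓡 n)) (𝓡 n) (fun z : G × G => z.1 * z.2) (φ u, u⁻¹)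
        (modelDeriv (𝓡 n) (𝓡 n) φ u ξ, modelDeriv (𝓡 n) (𝓡 n) (fun v : G => v⁻¹) u ξ) := by
  have hi : MDifferentiableAt (𝓡 n) (𝓡 n) (fun v : G => v⁻¹) u :=
    (contMDiff_inv (𝓡 n) ∞).mdifferentiableAt (by simp)
  have h1 : modelDeriv (𝓡 n) ((𝓡 n).prod (𝓡 n)) (fun v => (φ v, v⁻¹)) u ξ =
      (modelDeriv (𝓡 n) (𝓡 n) φ u ξ, modelDeriv (𝓡 n) (𝓡 n) (fun v : G => v⁻¹) u ξ) :=
    congrArg (fun L : EuclideanSpace ℝ (Fin n) →L[ℝ] _ => L ξ) (mfderiv_prodMk hφ hi)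
  rw [← h1]
  exact modelDeriv_comp (g := fun z : G × G => z.1 * z.2) (f := fun v => (φ v, v⁻¹)) rfl
    ((contMDiff_mul (𝓡 n) ∞).mdifferentiableAt (by simp)) (hφ.prodMk hi) (.of_forall fun _ => rfl) ξ

/-- A map preserving the Maurer-Cartan form is locally a left multiplication. -/
theorem eventually_eq_mul_of_pullback_maurerCartan {φ : G → G} {u : G}
    (hφ : ∀ᶠ v in 𝓝 u, MDifferentiableAt (𝓡 n) (𝓡 n) φ v)
    (hω : ∀ᶠ v in 𝓝 u, ∀ ξ : EuclideanSpace ℝ (Fin n),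
      (maurerCartan (n := n) (φ v) (modelDeriv (𝓡 n) (𝓡 n) φ v ξ) : EuclideanSpace ℝ (Fin n)) =
        maurerCartan (n := n) v ξ) :
    ∀ᶠ v in 𝓝 u, φ v * v⁻¹ = φ u * u⁻¹ := by
  have hi : ∀ v, MDifferentiableAt (𝓡 n) (𝓡 n) (fun v : G => v⁻¹) v := fun v =>
    (contMDiff_inv (𝓡 n) ∞).mdifferentiableAt (by simp)
  refine eventually_eq_of_modelDeriv_eq_zero (k := n) (l := n) (f := fun v => φ v * v⁻¹) ?_ ?_
  · filter_upwards [hφ] with v hv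
    exact MDifferentiableAt.comp (I' := (𝓡 n).prod (𝓡 n)) (f := fun v => (φ v, v⁻¹)) v
      ((contMDiff_mul (𝓡 n) ∞).mdifferentiableAt (by simp)) (hv.prodMk (hi v))
  · filter_upwards [hφ, hω] with v hv hωv ξ
    -- The left translation agreeing with `φ` at `v`. Both preserve the injective Maurer-Cartan
    -- form, so their derivatives at `v` agree too, while `φ' x * x⁻¹` is constant.
    let φ' : G → G := fun x => φ v * v⁻¹ * x
    have hφ' : MDifferentiableAt (𝓡 n) (𝓡 n) φ' v := mdifferentiableAt_mul_left _ v
    have hval : φ' v = φ v := by simp [φ']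
    have hder : modelDeriv (𝓡 n) (𝓡 n) φ' v ξ = modelDeriv (𝓡 n) (𝓡 n) φ v ξ := by
      refine (maurerCartan_injective (n := n) (φ v)) (Eq.trans ?_ (hωv ξ).symm)
      rw [maurerCartan_eq, maurerCartan_eq]
      refine (modelDeriv_comp hval (mdifferentiableAt_mul_left _ _) hφ'
        (.of_forall fun x => ?_) ξ).symm
      simp [φ', mul_assoc]
    have h1 := modelDeriv_mul_inv hφ' ξ
    rw [hval, hder, ← modelDeriv_mul_inv hv ξ] at h1
    rw [← h1, modelDeriv_congr (g := fun _ => φ v * v⁻¹) (.of_forall fun x => by simp [φ']),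
      modelDeriv_const]

end Rigidity

/-! ### Left multiplications as diffeomorphisms -/

section LeftMultiplication

variable {n p m : ℕ} {G : Type*} [Group G] [TopologicalSpace G]
  [ChartedSpace (EuclideanSpace ℝ (Fin n)) G] [LieGroup (𝓡 n) ∞ G]
  (P : Subgroup G) [ChartedSpace (EuclideanSpace ℝ (Fin p)) P]
  [ChartedSpace (EuclideanSpace ℝ (Fin m)) (G ⧸ P)]

/-- Left multiplication by `a`, as a diffeomorphism from an open set onto its image. -/
def mulLeftPartialDiffeomorph (a : G) (V : Set G) (hV : IsOpen V) :
    PartialDiffeomorph (𝓡 n) (𝓡 n) G G ∞ where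
  toFun u := a * u
  invFun u := a⁻¹ * u
  source := V
  target := (fun u => a⁻¹ * u) ⁻¹' V
  map_source' u hu := by simpa using hu
  map_target' u hu := hu
  left_inv' u _ := by simp
  right_inv' u _ := by simp
  open_source := hV
  open_target := hV.preimage (contMDiff_mul_left (I := 𝓡 n) (n := ∞) (a := a⁻¹)).continuous
  contMDiffOn_toFun := (contMDiff_mul_left (I := 𝓡 n) (n := ∞) (a := a)).contMDiffOn
  contMDiffOn_invFun := (contMDiff_mul_left (I := 𝓡 n) (n := ∞) (a := a⁻¹)).contMDiffOn

lemma contMDiff_smul_quotient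
    (hq : Manifold.IsSubmersion (𝓡 n) (𝓡 m) ∞ (QuotientGroup.mk : G → G ⧸ P)) (a : G) :
    ContMDiff (𝓡 m) (𝓡 m) ∞ (fun y : G ⧸ P => a • y) := by
  intro y
  obtain ⟨u, rfl⟩ := QuotientGroup.mk_surjective y
  obtain ⟨U, σ, hU, huU, hσ, hqσ⟩ := exists_local_section hq u
  have h1 : ContMDiffOn (𝓡 m) (𝓡 m) ∞ (fun y => (QuotientGroup.mk (a * σ y) : G ⧸ P)) U :=
    hq.contMDiff.comp_contMDiffOn
      ((contMDiff_mul_left (I := 𝓡 n) (n := ∞) (a := a)).comp_contMDiffOn hσ)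
  refine (h1.contMDiffAt (hU.mem_nhds huU)).congr_of_eventuallyEq ?_
  filter_upwards [hU.mem_nhds huU] with z hz
  have h2 := hqσ z hz
  conv_lhs => rw [← h2]
  rfl

/-- Left multiplication by `a` on `G/P`. -/
def smulPartialDiffeomorph
    (hq : Manifold.IsSubmersion (𝓡 n) (𝓡 m) ∞ (QuotientGroup.mk : G → G ⧸ P)) (a : G) :
    PartialDiffeomorph (𝓡 m) (𝓡 m) (G ⧸ P) (G ⧸ P) ∞ where
  toFun y := a • y
  invFun y := a⁻¹ • y
  source := Set.univ
  target := Set.univ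
  map_source' _ _ := trivial
  map_target' _ _ := trivial
  left_inv' y _ := by simp
  right_inv' y _ := by simp
  open_source := isOpen_univ
  open_target := isOpen_univ
  contMDiffOn_toFun := (contMDiff_smul_quotient P hq a).contMDiffOn
  contMDiffOn_invFun := (contMDiff_smul_quotient P hq a⁻¹).contMDiffOn

end LeftMultiplication

/-- A local section through `u`, constant in the fiber coordinate, splits the differential. Tangent
vectors of the base can then be tested upstairs with `ω`. -/
lemma CartanGeometry.modelDeriv_proj_surjective {n p b m : ℕ} {G : Type*} [Group G]
    [TopologicalSpace G] [ChartedSpace (EuclideanSpace ℝ (Fin n)) G] [LieGroup (𝓡 n) ∞ G]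
    {P : Subgroup G} [ChartedSpace (EuclideanSpace ℝ (Fin p)) P] [LieGroup (𝓡 p) ∞ P]
    {B : Type*} [TopologicalSpace B] [ChartedSpace (EuclideanSpace ℝ (Fin b)) B]
    [IsManifold (𝓡 b) ∞ B]
    {M : Type*} [TopologicalSpace M] [ChartedSpace (EuclideanSpace ℝ (Fin m)) M]
    [IsManifold (𝓡 m) ∞ M] (C : CartanGeometry n p b m P B M) (u : B) :
    Function.Surjective (modelDeriv (𝓡 b) (𝓡 m) C.proj u) := by
  obtain ⟨e, hx, -, hes, -⟩ := C.locallyTrivial (C.proj u)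
  have hu : u ∈ e.source := e.mem_source.2 hx
  let ι : M → M × P := fun y => (y, (e u).2)
  have hιu : ι (C.proj u) = e u := Prod.ext (e.coe_fst hu).symm rfl
  have h1 : MDifferentiableAt ((𝓡 m).prod (𝓡 p)) (𝓡 b) e.toOpenPartialHomeomorph.symm
      (ι (C.proj u)) := by
    rw [hιu]
    exact (hes.contMDiffAt (e.open_target.mem_nhds (e.map_source hu))).mdifferentiableAt (by simp)
  have h2 : MDifferentiableAt (𝓡 m) ((𝓡 m).prod (𝓡 p)) ι (C.proj u) :=
    mdifferentiableAt_id.prodMk mdifferentiableAt_const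
  let σ : M → B := fun y => e.toOpenPartialHomeomorph.symm (ι y)
  have hσu : σ (C.proj u) = u := by
    simp only [σ, hιu]
    exact e.toOpenPartialHomeomorph.left_inv hu
  have hσ : MDifferentiableAt (𝓡 m) (𝓡 b) σ (C.proj u) :=
    MDifferentiableAt.comp (I' := (𝓡 m).prod (𝓡 p)) _ h1 h2
  intro v
  refine ⟨modelDeriv (𝓡 m) (𝓡 b) σ (C.proj u) v, ?_⟩
  refine modelDeriv_leftInverse hσu (C.contMDiff_proj.mdifferentiableAt (by simp)) hσ ?_ v
  filter_upwards [e.open_baseSet.mem_nhds hx] with y hy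
  exact e.proj_symm_apply' hy

/-! ### Symmetries of the homogeneous model -/

section HomogeneousSymmetries

variable {n p m : ℕ} {G : Type*} [Group G] [TopologicalSpace G]
  [ChartedSpace (EuclideanSpace ℝ (Fin n)) G] [LieGroup (𝓡 n) ∞ G]
  {D : OneGrading (GroupLieAlgebra (𝓡 n) G)}
  {P : Subgroup G} [ChartedSpace (EuclideanSpace ℝ (Fin p)) P] [LieGroup (𝓡 p) ∞ P]
  [ChartedSpace (EuclideanSpace ℝ (Fin m)) (G ⧸ P)] [IsManifold (𝓡 m) ∞ (G ⧸ P)]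

/-- Equivariance cancels the factor from `P`. Since `φ u * u⁻¹` then depends only on the coset, no
connectedness of `P` or of the preimage of `U` is needed. -/
lemma mul_inv_eq_of_mk_eq
    {hP : Manifold.IsSmoothEmbedding (𝓡 p) (𝓡 n) ∞ (Subtype.val : P → G)}
    {hq : Manifold.IsSubmersion (𝓡 n) (𝓡 m) ∞ (QuotientGroup.mk : G → G ⧸ P)}
    {U : Set (G ⧸ P)} {φ : PartialDiffeomorph (𝓡 n) (𝓡 n) G G ∞}
    (hφ : (homogeneousModel P hP hq).IsLocalAutomorphism U φ) {u v : G} (hu : (u : G ⧸ P) ∈ U)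
    (huv : (u : G ⧸ P) = v) : φ u * u⁻¹ = φ v * v⁻¹ := by
  have h1 : u⁻¹ * v ∈ P := QuotientGroup.eq.1 huv
  have h2 : φ (u * (u⁻¹ * v)) = φ u * (u⁻¹ * v) := hφ.equivariant u hu ⟨u⁻¹ * v, h1⟩
  rw [mul_inv_cancel_left] at h2
  rw [h2]
  simp [mul_assoc]

lemma eventually_mul_inv_eq
    {hP : Manifold.IsSmoothEmbedding (𝓡 p) (𝓡 n) ∞ (Subtype.val : P → G)}
    {hq : Manifold.IsSubmersion (𝓡 n) (𝓡 m) ∞ (QuotientGroup.mk : G → G ⧸ P)}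
    {U : Set (G ⧸ P)} (hU : IsOpen U) {φ : PartialDiffeomorph (𝓡 n) (𝓡 n) G G ∞}
    (hφ : (homogeneousModel P hP hq).IsLocalAutomorphism U φ) {u : G} (hu : (u : G ⧸ P) ∈ U) :
    ∀ᶠ v in 𝓝 u, φ v * v⁻¹ = φ u * u⁻¹ := by
  have hV : ∀ᶠ v : G in 𝓝 u, (v : G ⧸ P) ∈ U :=
    (hU.preimage hq.contMDiff.continuous).mem_nhds hu
  refine eventually_eq_mul_of_pullback_maurerCartan (hV.mono fun v hv => ?_)
    (hV.mono fun v hv ξ => hφ.pullback_omega v hv ξ)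
  exact φ.mdifferentiableAt (by simp) (by rw [hφ.source_eq]; exact hv)

theorem exists_eq_smul_of_isSymmetryOn (hP : IsParabolicSubgroup p D P)
    {hq : Manifold.IsSubmersion (𝓡 n) (𝓡 m) ∞ (QuotientGroup.mk : G → G ⧸ P)}
    {U : Set (G ⧸ P)} {s : PartialDiffeomorph (𝓡 m) (𝓡 m) (G ⧸ P) (G ⧸ P) ∞}
    (hs : (homogeneousModel P hP.isSmoothEmbedding hq).IsSymmetryOn ((1 : G) : G ⧸ P) U s) :
    ∃ g ∈ P, ActsAsNegId D g ∧ (s : G ⧸ P → G ⧸ P) =ᶠ[𝓝 ((1 : G) : G ⧸ P)] (fun y => g • y) ∧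
      (IsPreconnected U → ∀ y ∈ U, s y = g • y) := by
  have := topologicalGroup_of_lieGroup (𝓡 n) ∞ (G := G)
  obtain ⟨φ, hφ, hcov⟩ := hs.covered
  obtain ⟨h, hh, hneg⟩ := hs.exists_actsAsNegId hP hφ hcov (u := (1 : G)) rfl
  have hφ1 : φ 1 = (h : G) := hh.trans (one_mul _)
  have hopen : IsOpenMap (QuotientGroup.mk : G → G ⧸ P) := QuotientGroup.isOpenMap_coe
  have hs' : ∀ u : G, (u : G ⧸ P) ∈ U → φ u * u⁻¹ = h →
      s (u : G ⧸ P) = (h : G) • (u : G ⧸ P) := by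
    intro u hu hφu
    have h1 : ((φ u : G) : G ⧸ P) = s (u : G ⧸ P) := hcov u hu
    rw [← h1, mul_inv_eq_iff_eq_mul.1 hφu]
    rfl
  have hconst : φ (1 : G) * (1 : G)⁻¹ = h := by rw [hφ1, inv_one, mul_one]
  have hVo : IsOpen ((QuotientGroup.mk : G → G ⧸ P) ⁻¹' U) :=
    hs.isOpen.preimage hq.contMDiff.continuous
  refine ⟨h, h.2, hneg, ?_, fun hpre => ?_⟩
  · have h1 := (eventually_mul_inv_eq hs.isOpen hφ hs.mem).and (hVo.mem_nhds hs.mem)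
    have h2 := hopen.image_mem_nhds h1
    filter_upwards [h2] with y hy
    obtain ⟨u, ⟨hu, huU⟩, rfl⟩ := hy
    exact hs' u huU (hu.trans hconst)
  -- `A` and `A'` are open by local constancy, and their images in `G/P` are open, disjoint and
  -- cover `U`. The image of `A` contains the origin, so it is all of `U`.
  · let A : Set G := {u | (u : G ⧸ P) ∈ U ∧ φ u * u⁻¹ = h}
    let A' : Set G := {u | (u : G ⧸ P) ∈ U ∧ φ u * u⁻¹ ≠ h}
    have hA : IsOpen A := isOpen_iff_mem_nhds.2 fun u hu => by
      filter_upwards [eventually_mul_inv_eq hs.isOpen hφ hu.1,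
        hVo.mem_nhds hu.1] with v hv hvU using ⟨hvU, hv.trans hu.2⟩
    have hA' : IsOpen A' := isOpen_iff_mem_nhds.2 fun u hu => by
      filter_upwards [eventually_mul_inv_eq hs.isOpen hφ hu.1,
        hVo.mem_nhds hu.1] with v hv hvU using ⟨hvU, hv ▸ hu.2⟩
    have hsub := hpre.subset_left_of_subset_union (hopen _ hA) (hopen _ hA')
      (Set.disjoint_left.2 ?_) (fun y hy => ?_) ⟨_, hs.mem, 1, ⟨hs.mem, hconst⟩, rfl⟩
    · intro y hy
      obtain ⟨u, ⟨huU, hu⟩, rfl⟩ := hsub hy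
      exact hs' u huU hu
    · rintro _ ⟨u, ⟨huU, hu⟩, rfl⟩ ⟨v, ⟨hvU, hv⟩, huv⟩
      exact hv ((mul_inv_eq_of_mk_eq hφ hvU huv).trans hu)
    · obtain ⟨u, rfl⟩ := QuotientGroup.mk_surjective y
      by_cases hu : φ u * u⁻¹ = h
      · exact Or.inl ⟨u, ⟨hy, hu⟩, rfl⟩
      · exact Or.inr ⟨u, ⟨hy, hu⟩, rfl⟩

/-- The left multiplication by a conjugate `a k a⁻¹` of an element acting as `-id` on `𝔤₋₁` is a
symmetry with center `a P`. -/
theorem isSymmetryOn_of_eq_smul (hP : IsParabolicSubgroup p D P)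
    (hq : Manifold.IsSubmersion (𝓡 n) (𝓡 m) ∞ (QuotientGroup.mk : G → G ⧸ P))
    {a k : G} (hk : k ∈ P) (hneg : ActsAsNegId D k) {U : Set (G ⧸ P)} (hU : IsOpen U)
    (haU : (a : G ⧸ P) ∈ U) {s : PartialDiffeomorph (𝓡 m) (𝓡 m) (G ⧸ P) (G ⧸ P) ∞}
    (hUs : U ⊆ s.source) (hs : ∀ y ∈ U, s y = (a * k * a⁻¹) • y) :
    (homogeneousModel P hP.isSmoothEmbedding hq).IsSymmetryOn (a : G ⧸ P) U s := by
  let C := homogeneousModel P hP.isSmoothEmbedding hq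
  have hVo : IsOpen ((QuotientGroup.mk : G → G ⧸ P) ⁻¹' U) := hU.preimage hq.contMDiff.continuous
  have hpd : ∀ u : G, MDifferentiableAt (𝓡 n) (𝓡 m) C.proj u := fun u =>
    C.contMDiff_proj.mdifferentiableAt (by simp)
  have hcenter : s (a : G ⧸ P) = a := by
    rw [hs _ haU]
    have h1 : (a * k * a⁻¹) • (a : G ⧸ P) = ((a * k * a⁻¹ * a : G) : G ⧸ P) := rfl
    rw [h1, inv_mul_cancel_right]
    exact QuotientGroup.mk_mul_of_mem a hk
  refine ⟨hU, haU, hUs, hcenter, fun v => ?_,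
    mulLeftPartialDiffeomorph (a * k * a⁻¹) _ hVo, ⟨rfl, fun u _ h => ?_, fun u _ ξ => ?_⟩,
    fun u hu => (hs _ hu).symm⟩
  · obtain ⟨ξ, rfl⟩ := C.modelDeriv_proj_surjective a v
    -- The extra right factor `k⁻¹ ∈ P` is invisible in `G/P` but makes the lift fix `a`. In the
    -- left trivialization its differential at `a` is `Ad k`.
    let R : G → G := fun x => a * k * a⁻¹ * x * k⁻¹
    have hRa : R a = a := by simp [R]
    have hR : MDifferentiableAt (𝓡 n) (𝓡 n) R a :=
      MDifferentiableAt.comp (I' := 𝓡 n) a (mdifferentiableAt_mul_right k⁻¹ _)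
        (mdifferentiableAt_mul_left (a * k * a⁻¹) a)
    let η := modelDeriv (𝓡 n) (𝓡 n) R a ξ
    have hη : modelDeriv (𝓡 n) (𝓡 n) (fun x : G => a⁻¹ * x) a η =
        modelDeriv (𝓡 n) (𝓡 n) (fun x : G => k * x * k⁻¹) 1
          (modelDeriv (𝓡 n) (𝓡 n) (fun x : G => a⁻¹ * x) a ξ) := by
      rw [← modelDeriv_comp (h := (fun x : G => a⁻¹ * x) ∘ R) hRa (mdifferentiableAt_mul_left _ _)
        hR (.of_forall fun _ => rfl)]
      refine modelDeriv_comp (inv_mul_cancel a) (mdifferentiableAt_conj k 1)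
        (mdifferentiableAt_mul_left _ _) (.of_forall fun x => ?_) ξ
      simp [R, mul_assoc]
    have hsη : modelDeriv (𝓡 m) (𝓡 m) s (a : G ⧸ P) (modelDeriv (𝓡 n) (𝓡 m) C.proj a ξ) =
        modelDeriv (𝓡 n) (𝓡 m) C.proj a η := by
      have hsd : MDifferentiableAt (𝓡 m) (𝓡 m) s (a : G ⧸ P) :=
        s.mdifferentiableAt (by simp) (hUs haU)
      refine (modelDeriv_comp (h := fun x => s (C.proj x)) (f := C.proj) rfl hsd (hpd a)
        (.of_forall fun _ => rfl) ξ).symm.trans ?_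
      refine modelDeriv_comp hRa (hpd a) hR ?_ ξ
      filter_upwards [hVo.mem_nhds haU] with x hx
      refine (hs _ hx).trans ?_
      exact (QuotientGroup.mk_mul_of_mem (a * k * a⁻¹ * x) (P.inv_mem hk)).symm
    refine hsη.trans (eq_neg_of_add_eq_zero_left ?_)
    have h1 : C.omega a (η + ξ) ∈ D.filt 0 := by
      have h2 : C.omega a (η + ξ) = C.omega a η + C.omega a ξ := map_add (C.omega a) η ξ
      have h3 : C.omega a η = Ad k (C.omega a ξ) := hη
      rw [h2, h3]
      obtain ⟨X, hX, Z, hZ, hXZ⟩ := D.exists_add (C.omega a ξ)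
      rw [← hXZ, map_add, add_add_add_comm]
      exact add_mem ((actsAsNegId_iff D k).1 hneg X hX) (add_mem (hP.ad_mem k hk 0 Z hZ) hZ)
    rw [← map_add]
    exact (C.modelDeriv_proj_eq_zero_iff hP a (η + ξ)).2 h1
  · exact (mul_assoc _ _ _).symm
  · refine (modelDeriv_comp (I := 𝓡 n) (I' := 𝓡 n) (I'' := 𝓡 n) (h := fun x : G => u⁻¹ * x)
      (g := fun x : G => (a * k * a⁻¹ * u)⁻¹ * x) (f := fun x : G => a * k * a⁻¹ * x) rfl
      (mdifferentiableAt_mul_left _ _) (mdifferentiableAt_mul_left _ _)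
      (.of_forall fun x => ?_) ξ).symm
    simp [mul_assoc]

end HomogeneousSymmetries

/-- Follows by testing against linear functionals vanishing on `K`. It turns `Ad`-stability near the
unit into stability under the Lie bracket. -/
lemma modelDeriv_mem_of_eventually_mem {n l : ℕ}
    {M : Type*} [TopologicalSpace M] [ChartedSpace (EuclideanSpace ℝ (Fin n)) M]
    {F : M → EuclideanSpace ℝ (Fin l)} {x : M} (hF : MDifferentiableAt (𝓡 n) (𝓡 l) F x)
    (K : Submodule ℝ (EuclideanSpace ℝ (Fin l))) (hK : ∀ᶠ y in 𝓝 x, F y ∈ K)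
    (v : EuclideanSpace ℝ (Fin n)) : modelDeriv (𝓡 n) (𝓡 l) F x v ∈ K := by
  by_contra hv
  obtain ⟨f, hfv, hKf⟩ := Submodule.exists_le_ker_of_notMem hv
  let L : EuclideanSpace ℝ (Fin l) →L[ℝ] ℝ := LinearMap.toContinuousLinearMap f
  have hL : modelDeriv (𝓡 l) 𝓘(ℝ, ℝ) L (F x) = L := mfderiv_eq_fderiv.trans L.fderiv
  have h1 := modelDeriv_comp (I'' := 𝓘(ℝ, ℝ)) (h := fun _ => (0 : ℝ)) (g := L) rfl
    L.differentiableAt.mdifferentiableAt hF (hK.mono fun y hy => (hKf hy).symm) v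
  rw [modelDeriv_const, hL] at h1
  exact hfv h1.symm

/-! ### Infinitely many germs of symmetries -/

section Effective

variable {n p m : ℕ} {G : Type*} [Group G] [TopologicalSpace G]
  [ChartedSpace (EuclideanSpace ℝ (Fin n)) G] [LieGroup (𝓡 n) ∞ G]
  {D : OneGrading (GroupLieAlgebra (𝓡 n) G)}

/-- If the orbit of `Y` under `Ad` stays in `𝔭` near the unit, then `Y = 0`. -/
theorem eq_zero_of_eventually_Ad_mem (hss : LieAlgebra.IsSemisimple ℝ (GroupLieAlgebra (𝓡 n) G))
    {Y : GroupLieAlgebra (𝓡 n) G} (hY : ∀ᶠ x in 𝓝 (1 : G), Ad x Y ∈ D.filt 0) : Y = 0 := by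
  have := topologicalGroup_of_lieGroup (𝓡 n) ∞ (G := G)
  let K : Submodule ℝ (GroupLieAlgebra (𝓡 n) G) :=
    { carrier := {Y | ∀ᶠ x in 𝓝 (1 : G), Ad x Y ∈ D.filt 0}
      add_mem' := fun {Y Z} hY hZ => by
        filter_upwards [hY, hZ] with x hx hx'
        rw [map_add]
        exact add_mem hx hx'
      zero_mem' := .of_forall fun x => by rw [map_zero]; exact zero_mem _
      smul_mem' := fun c Y hY => by
        filter_upwards [hY] with x hx
        rw [map_smul]
        exact Submodule.smul_mem _ c hx }
  have hK : ∀ Y, Y ∈ K ↔ ∀ᶠ x in 𝓝 (1 : G), Ad x Y ∈ D.filt 0 := fun _ => Iff.rfl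
  let I : LieIdeal ℝ (GroupLieAlgebra (𝓡 n) G) :=
    { K with
      lie_mem := fun {X Y} hY => by
        -- Because `Ad x (Ad y Y) = Ad (x y) Y`, a condition holding near `1` for `Y` also holds for
        -- `Ad y Y` with `y` near `1`. Differentiating in `y` then gives `[X, Y] ∈ K`.
        have h1 : ∀ᶠ y in 𝓝 (1 : G), Ad y Y ∈ K := by
          have h2 := eventually_eventually_nhds.2 ((hK Y).1 hY)
          filter_upwards [h2] with y hy
          have h3 : Filter.Tendsto (fun x : G => x * y) (𝓝 1) (𝓝 y) := by
            have h4 := (continuous_mul_const y).tendsto (1 : G)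
            rwa [one_mul] at h4
          refine (h3.eventually hy).mono fun x hx => ?_
          have h5 : Ad (x * y) Y = Ad x (Ad y Y) := Ad_mul x y Y
          rwa [h5] at hx
        have h6 := modelDeriv_mem_of_eventually_mem (F := fun y : G => Ad (n := n) y Y)
          (mdifferentiableAt_Ad Y 1) K h1 X
        exact (congrArg (fun Z : GroupLieAlgebra (𝓡 n) G => Z ∈ K) (modelDeriv_Ad_one X Y)).mp h6 }
  have hI : I = ⊥ := D.eq_bot_of_le_filt_zero I fun Z hZ => by
    have h1 : Ad (1 : G) Z ∈ D.filt 0 := ((hK Z).1 hZ).self_of_nhds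
    have h2 : Ad (1 : G) Z = Z := Ad_one Z
    rwa [h2] at h1
  have hYI : Y ∈ I := hY
  rwa [hI, LieSubmodule.mem_bot] at hYI

variable {P : Subgroup G} [ChartedSpace (EuclideanSpace ℝ (Fin p)) P]

/-- `Ad g` preserves `𝔭`, so the condition is automatic there. Stated on all of `𝔤`, it passes to
inverses and to conjugates by `P`. -/
lemma actsAsNegId_iff_forall (hP : IsParabolicSubgroup p D P) {g : G} (hg : g ∈ P) :
    ActsAsNegId D g ↔ ∀ X, Ad g X + X ∈ D.filt 0 := by
  rw [actsAsNegId_iff]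
  refine ⟨fun h X => ?_, fun h X _ => h X⟩
  obtain ⟨Y, hY, Z, hZ, rfl⟩ := D.exists_add X
  rw [map_add, add_add_add_comm]
  exact add_mem (h Y hY) (add_mem (hP.ad_mem g hg 0 Z hZ) hZ)

lemma ActsAsNegId.inv (hP : IsParabolicSubgroup p D P) {g : G} (hg : g ∈ P)
    (h : ActsAsNegId D g) : ActsAsNegId D g⁻¹ := by
  rw [actsAsNegId_iff_forall hP (P.inv_mem hg)]
  intro X
  have h1 := hP.ad_mem g⁻¹ (P.inv_mem hg) 0 _ ((actsAsNegId_iff_forall hP hg).1 h X)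
  have h2 : Ad g⁻¹ (Ad g X) = X := Ad_inv_Ad g X
  rwa [map_add, h2, add_comm] at h1

lemma ActsAsNegId.conj (hP : IsParabolicSubgroup p D P) {g b : G} (hg : g ∈ P) (hb : b ∈ P)
    (h : ActsAsNegId D g) : ActsAsNegId D (b * g * b⁻¹) := by
  rw [actsAsNegId_iff_forall hP (P.mul_mem (P.mul_mem hb hg) (P.inv_mem hb))]
  intro X
  have h1 := hP.ad_mem b hb 0 _ ((actsAsNegId_iff_forall hP hg).1 h (Ad b⁻¹ X))
  have h2 : Ad b (Ad b⁻¹ X) = X := Ad_Ad_inv b X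
  have h3 : Ad (b * g * b⁻¹) X = Ad b (Ad g (Ad b⁻¹ X)) :=
    (Ad_mul (b * g) b⁻¹ X).trans (Ad_mul b g _)
  rwa [map_add, h2, ← h3] at h1

variable [LieGroup (𝓡 p) ∞ P]
  [ChartedSpace (EuclideanSpace ℝ (Fin m)) (G ⧸ P)] [IsManifold (𝓡 m) ∞ (G ⧸ P)]

/-- An element acting as `-id` on `𝔤₋₁` does not commute, as a transformation of `G/P` near the
origin, with the elements of `P` near the unit. -/
theorem ActsAsNegId.not_eventually_commute
    (hss : LieAlgebra.IsSemisimple ℝ (GroupLieAlgebra (𝓡 n) G)) (hP : IsParabolicSubgroup p D P)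
    (hq : Manifold.IsSubmersion (𝓡 n) (𝓡 m) ∞ (QuotientGroup.mk : G → G ⧸ P)) {g : G}
    (hg : g ∈ P) (hneg : ActsAsNegId D g) {V : Set G} (hV : V ∈ 𝓝 1)
    (hcomm : ∀ᶠ c : P in 𝓝 1, ∀ x ∈ V, ((c * g * x : G) : G ⧸ P) = ((g * c * x : G) : G ⧸ P)) :
    False := by
  have := topologicalGroup_of_lieGroup (𝓡 n) ∞ (G := G)
  let C := homogeneousModel P hP.isSmoothEmbedding hq
  have hp : MDifferentiableAt (𝓡 n) (𝓡 m) C.proj 1 :=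
    C.contMDiff_proj.mdifferentiableAt (by simp)
  have hv : MDifferentiableAt (𝓡 p) (𝓡 n) (Subtype.val : P → G) 1 :=
    hP.isSmoothEmbedding.contMDiff.mdifferentiableAt (by simp)
  have hder : ∀ (a : G) (X : EuclideanSpace ℝ (Fin p)),
      modelDeriv (𝓡 p) (𝓡 m) (fun c : P => C.proj (a * c * a⁻¹)) 1 X =
        modelDeriv (𝓡 n) (𝓡 m) C.proj 1
          (modelDeriv (𝓡 n) (𝓡 n) (fun x : G => a * x * a⁻¹) 1
            (modelDeriv (𝓡 p) (𝓡 n) (Subtype.val : P → G) 1 X)) := by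
    intro a X
    have h1 : MDifferentiableAt (𝓡 p) (𝓡 n) (fun c : P => a * c * a⁻¹) 1 :=
      MDifferentiableAt.comp (I' := 𝓡 n) (1 : P) (mdifferentiableAt_conj a _) hv
    have h2 := modelDeriv_comp (I'' := 𝓡 n) (x := (1 : P)) (y := (1 : G)) (f := Subtype.val)
      (g := fun x : G => a * x * a⁻¹) (h := fun c : P => a * c * a⁻¹) rfl
      (mdifferentiableAt_conj a _) hv (.of_forall fun _ => rfl) X
    rw [← h2]
    exact modelDeriv_comp (f := fun c : P => a * c * a⁻¹) (by simp) hp h1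
      (.of_forall fun _ => rfl) X
  have hid : ∀ A ∈ D.filt 0, Ad g⁻¹ A = A := by
    intro A hA
    rw [← SetLike.mem_coe, ← hP.range_eq] at hA
    obtain ⟨X, rfl⟩ := hA
    let A : GroupLieAlgebra (𝓡 n) G := mfderiv (𝓡 p) (𝓡 n) (Subtype.val : P → G) 1 X
    have hmem : ∀ x ∈ V, Ad x⁻¹ (Ad g⁻¹ A - A) ∈ D.filt 0 := by
      intro x hx
      have h1 : modelDeriv (𝓡 p) (𝓡 m)
          (fun c : P => C.proj ((x⁻¹ * g⁻¹) * c * (x⁻¹ * g⁻¹)⁻¹)) 1 =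
          modelDeriv (𝓡 p) (𝓡 m) (fun c : P => C.proj (x⁻¹ * c * x⁻¹⁻¹)) 1 := by
        refine modelDeriv_congr ?_
        filter_upwards [hcomm] with c hc
        -- Translating `c g x P = g c x P` by `x⁻¹ g⁻¹` turns both sides into conjugates of `c`,
        -- whose derivatives at `c = 1` are given by `hder`.
        have h2 := congrArg (fun y : G ⧸ P => (x⁻¹ * g⁻¹) • y) (hc x hx)
        have h3 : ((x⁻¹ * g⁻¹ * (c * g * x) : G) : G ⧸ P) =
          ((x⁻¹ * g⁻¹ * (g * c * x) : G) : G ⧸ P) := h2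
        change ((x⁻¹ * g⁻¹ * c * (x⁻¹ * g⁻¹)⁻¹ : G) : G ⧸ P) = ((x⁻¹ * c * x⁻¹⁻¹ : G) : G ⧸ P)
        convert h3 using 2 <;> group
      have h4 : modelDeriv (𝓡 n) (𝓡 m) C.proj 1 (Ad (n := n) (x⁻¹ * g⁻¹) A) =
          modelDeriv (𝓡 n) (𝓡 m) C.proj 1 (Ad (n := n) x⁻¹ A) :=
        (hder _ X).symm.trans ((congrArg (fun L : EuclideanSpace ℝ (Fin p) →L[ℝ]
          EuclideanSpace ℝ (Fin m) => L X) h1).trans (hder _ X))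
      have h5 : Ad x⁻¹ (Ad g⁻¹ A - A) = Ad (x⁻¹ * g⁻¹) A - Ad x⁻¹ A :=
        (map_sub (Ad x⁻¹) _ _).trans
          (congrArg (fun Z : GroupLieAlgebra (𝓡 n) G => Z - Ad x⁻¹ A) (Ad_mul x⁻¹ g⁻¹ A).symm)
      have h6 := map_sub (modelDeriv (𝓡 n) (𝓡 m) C.proj 1)
        (Ad (n := n) (x⁻¹ * g⁻¹) A) (Ad (n := n) x⁻¹ A)
      have h7 := (C.modelDeriv_proj_eq_zero_iff hP 1 _).1 (h6.trans (sub_eq_zero.2 h4))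
      have h8 : C.omega (1 : G) (Ad (x⁻¹ * g⁻¹) A - Ad x⁻¹ A) =
        Ad (x⁻¹ * g⁻¹) A - Ad x⁻¹ A := maurerCartan_one _
      rw [h5, ← h8]
      exact h7
    have hev : ∀ᶠ x in 𝓝 (1 : G), Ad x (Ad g⁻¹ A - A) ∈ D.filt 0 := by
      have h1 : Filter.Tendsto (fun x : G => x⁻¹) (𝓝 1) (𝓝 1) := by
        have := (continuous_inv (G := G)).tendsto 1
        rwa [inv_one] at this
      filter_upwards [h1.eventually hV] with x hx
      simpa using hmem _ hx
    exact sub_eq_zero.1 (eq_zero_of_eventually_Ad_mem hss hev)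
  exact D.not_neg_of_id_on_filt_zero (Ad g⁻¹) (Ad_lie g⁻¹) hid
    ((actsAsNegId_iff D g⁻¹).1 (hneg.inv hP hg))

/-- With finitely many germs, `P` would be a countable union of closed sets on each of which the
conjugates `b g b⁻¹` act alike on a fixed neighborhood. Baire's theorem gives one of them interior.
-/
theorem infinite_symmetryGerms
    (hss : LieAlgebra.IsSemisimple ℝ (GroupLieAlgebra (𝓡 n) G)) (hP : IsParabolicSubgroup p D P)
    (hq : Manifold.IsSubmersion (𝓡 n) (𝓡 m) ∞ (QuotientGroup.mk : G → G ⧸ P)) {g : G}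
    (hg : g ∈ P) (hneg : ActsAsNegId D g) (y : G ⧸ P) :
    ((homogeneousModel P hP.isSmoothEmbedding hq).symmetryGerms y).Infinite := by
  have := topologicalGroup_of_lieGroup (𝓡 n) ∞ (G := G)
  have : T1Space (G ⧸ P) := ChartedSpace.t1Space (EuclideanSpace ℝ (Fin m)) (G ⧸ P)
  have : LocallyCompactSpace P := ChartedSpace.locallyCompactSpace (EuclideanSpace ℝ (Fin p)) P
  have : T1Space P := ChartedSpace.t1Space (EuclideanSpace ℝ (Fin p)) P
  obtain ⟨a, rfl⟩ := QuotientGroup.mk_surjective y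
  intro hfin
  let Γ := (homogeneousModel P hP.isSmoothEmbedding hq).symmetryGerms (a : G ⧸ P)
  have : Finite Γ := hfin
  have hk : ∀ b : P, (b * g * (b : G)⁻¹ : G) ∈ P := fun b =>
    P.mul_mem (P.mul_mem b.2 hg) (P.inv_mem b.2)
  let k : P → G := fun b => b * g * (b : G)⁻¹
  let γ : P → Γ := fun b => ⟨((fun z : G ⧸ P => (a * k b * a⁻¹) • z : G ⧸ P → G ⧸ P) :
    Filter.Germ (𝓝 (a : G ⧸ P)) (G ⧸ P)), smulPartialDiffeomorph P hq (a * k b * a⁻¹),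
    ⟨Set.univ, isSymmetryOn_of_eq_smul hP hq (hk b) (hneg.conj hP hg b.2) isOpen_univ trivial
      (Set.subset_univ _) fun _ _ => rfl⟩, rfl⟩
  let f : Γ → G ⧸ P → G ⧸ P := fun δ => Quotient.out δ.1
  have hf : ∀ δ : Γ, ((f δ : G ⧸ P → G ⧸ P) : Filter.Germ (𝓝 (a : G ⧸ P)) (G ⧸ P)) = δ.1 :=
    fun δ => Quotient.out_eq δ.1
  have hbasis : (𝓝 (1 : G)).IsCountablyGenerated := by
    rw [← (chartAt (EuclideanSpace ℝ (Fin n)) (1 : G)).symm_map_nhds_eq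
      (mem_chart_source (EuclideanSpace ℝ (Fin n)) (1 : G))]
    infer_instance
  obtain ⟨V, hV⟩ := (𝓝 (1 : G)).exists_antitone_basis
  -- The second index is the size of the neighborhood on which `b` realizes the germ. The
  -- representatives `f` need not be continuous: each condition concerns one fixed `x`, and points
  -- of `G/P` are closed.
  let T : Γ × ℕ → Set P := fun i =>
    {b | ∀ x ∈ V i.2, ((a * k b * x : G) : G ⧸ P) = f i.1 ((a * x : G) : G ⧸ P)}
  have hqc : Continuous (QuotientGroup.mk : G → G ⧸ P) := hq.contMDiff.continuous
  have hkc : Continuous k := by fun_prop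
  have hT : ∀ i, IsClosed (T i) := fun i => by
    simp only [T, Set.ofPred_forall]
    refine isClosed_iInter fun x => isClosed_iInter fun _ => ?_
    exact isClosed_singleton.preimage (hqc.comp (by fun_prop : Continuous fun b => a * k b * x))
  have hcov : ⋃ i, T i = Set.univ := by
    refine Set.eq_univ_of_forall fun b => ?_
    have h1 : f (γ b) =ᶠ[𝓝 (a : G ⧸ P)] fun z => (a * k b * a⁻¹) • z :=
      Filter.Germ.coe_eq.1 (hf (γ b))
    have h2 : Filter.Tendsto (fun x : G => ((a * x : G) : G ⧸ P)) (𝓝 1) (𝓝 (a : G ⧸ P)) := by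
      have h3 := (hqc.comp (continuous_const_mul a)).tendsto (1 : G)
      rwa [Function.comp_apply, mul_one] at h3
    obtain ⟨N, hN⟩ := hV.mem_iff.1 (h2.eventually h1)
    refine Set.mem_iUnion.2 ⟨(γ b, N), fun x hx => ?_⟩
    have h4 : ((a * k b * a⁻¹ * (a * x) : G) : G ⧸ P) = f (γ b) ((a * x : G) : G ⧸ P) :=
      (hN hx).symm
    rw [← h4]
    congr 1
    group
  obtain ⟨i, b₀, hb₀⟩ := nonempty_interior_of_iUnion_of_closed hT hcov
  have hb₀T : b₀ ∈ T i := interior_subset hb₀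
  refine (hneg.conj hP hg b₀.2).not_eventually_commute hss hP hq (hk b₀) (hV.mem i.2) ?_
  -- Perturbing `b₀` to `c⁻¹ b₀` conjugates `k b₀` to `c⁻¹ (k b₀) c`. Equality of the two actions on
  -- `V i.2` says that `k b₀` commutes with `c` there.
  have h5 : Filter.Tendsto (fun c : P => c⁻¹ * b₀) (𝓝 1) (𝓝 b₀) := by
    have h6 : Continuous fun c : P => c⁻¹ * b₀ := by fun_prop
    have h7 := h6.tendsto 1
    rwa [inv_one, one_mul] at h7
  filter_upwards [h5.eventually (mem_interior_iff_mem_nhds.1 hb₀)] with c hc x hx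
  have h8 : ((a * k (c⁻¹ * b₀) * x : G) : G ⧸ P) = ((a * k b₀ * x : G) : G ⧸ P) :=
    (hc x hx).trans (hb₀T x hx).symm
  have h9 := congrArg (fun z : G ⧸ P => ((c : G) * a⁻¹) • z) h8
  have h10 : (((c : G) * a⁻¹ * (a * k (c⁻¹ * b₀) * x) : G) : G ⧸ P) =
    (((c : G) * a⁻¹ * (a * k b₀ * x) : G) : G ⧸ P) := h9
  have h11 : (c : G) * a⁻¹ * (a * k (c⁻¹ * b₀) * x) = b₀ * g * (b₀ : G)⁻¹ * c * x := by
    simp only [k, Subgroup.coe_mul, InvMemClass.coe_inv]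
    group
  have h12 : (c : G) * a⁻¹ * (a * k b₀ * x) = c * (b₀ * g * (b₀ : G)⁻¹) * x := by
    simp only [k]
    group
  rw [h11, h12] at h10
  exact h10.symm

end Effective

end ParabolicGeometry

/-! ### The proposition -/

theorem mainTheorem10
    {n p m : ℕ}
    {G : Type*} [Group G] [TopologicalSpace G] [ChartedSpace (EuclideanSpace ℝ (Fin n)) G]
    [LieGroup (𝓡 n) ∞ G]
    (hss : LieAlgebra.IsSemisimple ℝ (GroupLieAlgebra (𝓡 n) G))
    (D : OneGrading (GroupLieAlgebra (𝓡 n) G))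
    (P : Subgroup G) [ChartedSpace (EuclideanSpace ℝ (Fin p)) P] [LieGroup (𝓡 p) ∞ P]
    (hP : IsParabolicSubgroup p D P)
    [ChartedSpace (EuclideanSpace ℝ (Fin m)) (G ⧸ P)] [IsManifold (𝓡 m) ∞ (G ⧸ P)]
    (hq : Manifold.IsSubmersion (𝓡 n) (𝓡 m) ∞ (QuotientGroup.mk : G → G ⧸ P)) :
    let C : CartanGeometry n p n m P G (G ⧸ P) := homogeneousModel P hP.isSmoothEmbedding hq
    let o : G ⧸ P := ((1 : G) : G ⧸ P)
    -- (1) near `o`, the symmetries at `o` are exactly the left multiplications by the elements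
    -- of `P` acting as `-id` on `𝔤₋₁`
    (∀ s : PartialDiffeomorph (𝓡 m) (𝓡 m) (G ⧸ P) (G ⧸ P) ∞, o ∈ s.source →
      (C.IsSymmetryAt o s ↔
        ∃ g ∈ P, ActsAsNegId D g ∧ (s : G ⧸ P → G ⧸ P) =ᶠ[𝓝 o] fun y => g • y)) ∧
    -- a symmetry is such a left multiplication on every connected domain of a covering automorphism
    (∀ (s : PartialDiffeomorph (𝓡 m) (𝓡 m) (G ⧸ P) (G ⧸ P) ∞) (U : Set (G ⧸ P)),
      IsPreconnected U → C.IsSymmetryOn o U s →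
        ∃ g ∈ P, ActsAsNegId D g ∧ ∀ y ∈ U, s y = g • y) ∧
    -- and all these left multiplications are globally defined symmetries
    (∀ g ∈ P, ActsAsNegId D g →
      ∃ s : PartialDiffeomorph (𝓡 m) (𝓡 m) (G ⧸ P) (G ⧸ P) ∞,
        (∀ y, s y = g • y) ∧ C.IsSymmetryOn o Set.univ s) ∧
    -- (2) one symmetry at `o` makes the model symmetric, with infinitely many symmetries (even up
    -- to equality near the center) at each point
    ((∃ s : PartialDiffeomorph (𝓡 m) (𝓡 m) (G ⧸ P) (G ⧸ P) ∞, C.IsSymmetryAt o s) →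
      C.IsSymmetric ∧ ∀ x : G ⧸ P, (C.symmetryGerms x).Infinite) ∧
    -- (3) without such elements, no Cartan geometry of type `(G, P)` admits a symmetry
    ((∀ g ∈ P, ¬ ActsAsNegId D g) →
      ∀ {b k : ℕ}
        {B : Type*} [TopologicalSpace B] [ChartedSpace (EuclideanSpace ℝ (Fin b)) B]
        [IsManifold (𝓡 b) ∞ B]
        {M : Type*} [TopologicalSpace M] [ChartedSpace (EuclideanSpace ℝ (Fin k)) M]
        [IsManifold (𝓡 k) ∞ M]
        (C' : CartanGeometry n p b k P B M) (x : M)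
        (s : PartialDiffeomorph (𝓡 k) (𝓡 k) M M ∞), ¬ C'.IsSymmetryAt x s) := by
  intro C o
  have hsmul : ∀ a k : G, k ∈ P → ActsAsNegId D k →
      C.IsSymmetryOn (a : G ⧸ P) Set.univ (smulPartialDiffeomorph P hq (a * k * a⁻¹)) :=
    fun a k hk hneg => isSymmetryOn_of_eq_smul hP hq hk hneg isOpen_univ trivial
      (Set.subset_univ _) fun _ _ => rfl
  refine ⟨fun s ho => ⟨?_, ?_⟩, fun s U hU hs => ?_, fun g hg hneg => ?_, ?_, ?_⟩
  · rintro ⟨U, hs⟩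
    obtain ⟨g, hg, hneg, hgs, -⟩ := exists_eq_smul_of_isSymmetryOn hP hs
    exact ⟨g, hg, hneg, hgs⟩
  · rintro ⟨g, hg, hneg, hgs⟩
    -- An open `U` inside both the source of `s` and the set where `s` equals the left
    -- multiplication; only there is a covering needed.
    obtain ⟨U, hUs, hU, hoU⟩ := mem_nhds_iff.1
      (Filter.inter_mem (s.open_source.mem_nhds ho) hgs)
    refine ⟨U, isSymmetryOn_of_eq_smul hP hq (a := 1) hg hneg hU hoU (fun y hy => (hUs hy).1)
      fun y hy => ?_⟩
    rw [one_mul, inv_one, mul_one]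
    exact (hUs hy).2
  · obtain ⟨g, hg, hneg, -, hgs⟩ := exists_eq_smul_of_isSymmetryOn hP hs
    exact ⟨g, hg, hneg, hgs hU⟩
  · refine ⟨_, fun y => ?_, hsmul 1 g hg hneg⟩
    change (1 * g * 1⁻¹) • y = g • y
    rw [one_mul, inv_one, mul_one]
  · rintro ⟨s, U, hs⟩
    obtain ⟨g, hg, hneg, -⟩ := exists_eq_smul_of_isSymmetryOn hP hs
    refine ⟨fun x => ?_, infinite_symmetryGerms hss hP hq hg hneg⟩
    obtain ⟨a, rfl⟩ := QuotientGroup.mk_surjective x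
    exact ⟨_, _, hsmul a g hg hneg⟩
  · rintro hno b k B _ _ _ M _ _ _ C' x s ⟨U, hs⟩
    obtain ⟨φ, hφ, hcov⟩ := hs.covered
    obtain ⟨u, hu⟩ := C'.exists_proj_eq x
    obtain ⟨h, -, hneg⟩ := hs.exists_actsAsNegId hP hφ hcov hu
    exact hno h h.2 hneg
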